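/- Let $F$ be a number field with ring of integers $\mathcal O$ and adele ring $\mathbb A$, and let $\mathfrak p\neq\mathfrak q$ be nonzero prime ideals of $\mathcal O$, of norms $p$ and $q$. For a finite place $v$ let $K_v=\mathrm{GL}_2(\mathcal O_v)\subset \mathrm{GL}_2(F_v)$ and let $\varpi_v$ be a uniformizer of $F_v$; for a nonzero ideal $\mathfrak a$ of $\mathcal O$ let $K_0(\mathfrak a)\subset\prod_{v<\infty}K_v$ be the subgroup of matrices $\left(\begin{smallmatrix} a&b\\ c&d\end{smallmatrix}\right)$ with $c_v\in\mathfrak a\mathcal O_v$ for all finite $v$. All these groups are viewed in $\mathrm{GL}_2(\mathbb A)$, with component $1$ at the remaining places. A unitary automorphic representation of $\mathrm{PGL}_2(\mathbb A)$ is an irreducible unitary representation with trivial central character that is either (isomorphic to) a closed subrepresentation of $L^2_{\mathrm{cusp}}(Z(\mathbb A)\mathrm{GL}_2(F)\backslash\mathrm{GL}_2(\mathbb A))$ or (Eisenstein) isomorphic to a principal series $\chi\boxplus\chi^{-1}$ with $\chi$ a unitary character of $F^\times\backslash\mathbb A^\times$. Its finite conductor is the nonzero ideal $\mathfrak c$ such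 that, for nonzero ideals $\mathfrak a$, there are nonzero $K_0(\mathfrak a)$-invariant vectors if and only if $\mathfrak c\mid\mathfrak a$. For a vector $\varphi$ of such a representation and a prime $\mathfrak a\in\{\mathfrak p,\mathfrak q\}$, $\varphi^{\mathfrak a}$ is its translate by the element of $\mathrm{GL}_2(\mathbb A)$ with component $\left(\begin{smallmatrix}1&\\&\varpi_{\mathfrak a}\end{smallmatrix}\right)$ at $\mathfrak a$ and $1$ elsewhere, and $\varphi^{\mathfrak q\mathfrak p}=(\varphi^{\mathfrak p})^{\mathfrak q}$. Let $\pi$ be a unitary automorphic representation of $\mathrm{PGL}_2(\mathbb A)$ of finite conductor $\mathfrak q$. Then the Hecke operator $$\mathrm T_{\mathfrak p}\varphi=\frac1{p^{1/2}}\int_{H_{\mathfrak p}}\pi(h)\varphi\,dh,\qquad H_{\mathfrak p}=K_{\mathfrak p}\left(\begin{smallmatrix}\varpi_{\mathfrak p}&\\&1\end{smallmatrix}\right)K_{\mathfrak p},$$ where $dh$ is the Haar measure on $\mathrm{GL}_2(F_{\mathfrak p})$ that gives $K_{\mathfrak p}$ measure $1$, acts on the $K_0(\mathfrak q)$-invariant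 vectors of $\pi$ by a real number $\lambda_\pi(\mathfrak p)$, and the Atkin–Lehner matrix $\left(\begin{smallmatrix}&-1\\\varpi_{\mathfrak q}&\end{smallmatrix}\right)\in\mathrm{GL}_2(F_{\mathfrak q})$ acts on them by a sign $\eta_\pi(\mathfrak q)\in\{-1,+1\}$, which is the same for every choice of the uniformizer. Moreover, let $\pi_1,\pi_2$ be unitary automorphic representations of $\mathrm{PGL}_2(\mathbb A)$, let $V\subseteq\pi$, $V_1\subseteq\pi_1$, $V_2\subseteq\pi_2$ be $\mathrm{GL}_2(\mathbb A)$-invariant linear subspaces (for instance the whole spaces, or the spaces of smooth vectors), and let $\ell:V\otimes V_1\otimes V_2\to\mathbb C$ be a $\mathrm{GL}_2(\mathbb A)$-invariant trilinear functional. If $\varphi\in V$ is $K_0(\mathfrak q)$-invariant and $\varphi_1\in V_1$, $\varphi_2\in V_2$ are invariant under $K_{\mathfrak p}$ and $K_{\mathfrak q}$, then, for all choices of the uniformizers, $$\frac{p+1}{p^{1/2}}\,\ell(\varphi,\varphi_1^{\mathfrak q\mathfrak p},\varphi_2^{\mathfrak p})=\lambda_\pi(\mathfrak p)\,\ell(\varphi,\varphi_1^{\mathfrak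 q},\varphi_2) \qquad\text{and}\qquad \ell(\varphi,\varphi_1,\varphi_2^{\mathfrak q})=\eta_\pi(\mathfrak q)\,\ell(\varphi,\varphi_1^{\mathfrak q},\varphi_2).$$ -/

import Mathlib

open NumberField IsDedekindDomain MeasureTheory
open scoped ENNReal

noncomputable section

namespace PGLTwo

variable (F : Type*) [Field F] [NumberField F]

/-! ### Adeles, local components and local inclusions -/

/-- The adele ring of the number field `F`. -/
abbrev Adele : Type _ := AdeleRing (𝓞 F) F

/-- The group `GL₂` of the adeles of `F`. -/
abbrev GLAdele : Type _ := GL (Fin 2) (Adele F)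

/-- The Borel structures. -/
instance : MeasurableSpace (Adele F) := borel _
instance : BorelSpace (Adele F) := ⟨rfl⟩
instance : MeasurableSpace (GLAdele F) := borel _
instance : BorelSpace (GLAdele F) := ⟨rfl⟩

variable {F}

instance (v : HeightOneSpectrum (𝓞 F)) :
    MeasurableSpace (GL (Fin 2) (v.adicCompletion F)) := borel _
instance (v : HeightOneSpectrum (𝓞 F)) :
    BorelSpace (GL (Fin 2) (v.adicCompletion F)) := ⟨rfl⟩

/-- The component of an adele at a finite place. -/
def finiteComponent (v : HeightOneSpectrum (𝓞 F)) : Adele F →+* v.adicCompletion F where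
  toFun x := x.2 v
  map_one' := rfl
  map_mul' _ _ := rfl
  map_zero' := rfl
  map_add' _ _ := rfl

/-- The component of an adele at an infinite place. -/
def infiniteComponent (w : InfinitePlace F) : Adele F →+* w.Completion where
  toFun x := x.1 w
  map_one' := rfl
  map_mul' _ _ := rfl
  map_zero' := rfl
  map_add' _ _ := rfl

open scoped Classical in
/-- The adele with component `x` at `v` and `0` at every other place. -/
def adeleSingle (v : HeightOneSpectrum (𝓞 F)) : v.adicCompletion F →ₙ+* Adele F where
  toFun x := ((0 : InfiniteAdeleRing F),
    (RestrictedProduct.single (fun v : HeightOneSpectrum (𝓞 F) => v.adicCompletionIntegers F) v x :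
      FiniteAdeleRing (𝓞 F) F))
  map_mul' x y := Prod.ext (mul_zero (0 : InfiniteAdeleRing F)).symm
    (FiniteAdeleRing.ext F fun w => congrFun (Pi.single_mul v x y) w)
  map_zero' := Prod.ext rfl (FiniteAdeleRing.ext F fun w => congrFun (Pi.single_zero v) w)
  map_add' x y := Prod.ext (zero_add (0 : InfiniteAdeleRing F)).symm
    (FiniteAdeleRing.ext F fun w => congrFun (Pi.single_add v x y) w)

/-- The inclusion of `GL₂(F_v)` in `GL₂` of the adeles: the matrix `g` is sent to the adelic matrix
with component `g` at `v` and the identity matrix at every other place. -/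
def localInclusion (v : HeightOneSpectrum (𝓞 F)) :
    GL (Fin 2) (v.adicCompletion F) →* GLAdele F :=
  Units.map
    { toFun := fun m => 1 + (m - 1).map (adeleSingle v)
      map_one' := by
        ext i j
        simp
      map_mul' := fun m n => by
        have h : ∀ a b : Matrix (Fin 2) (Fin 2) (v.adicCompletion F),
            (a * b).map (adeleSingle v) = a.map (adeleSingle v) * b.map (adeleSingle v) := by
          intro a b
          ext i j
          simp [Matrix.mul_apply, map_add, map_mul]
        have h' : ∀ a b : Matrix (Fin 2) (Fin 2) (v.adicCompletion F),
            (a + b).map (adeleSingle v) = a.map (adeleSingle v) + b.map (adeleSingle v) := by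
          intro a b
          ext i j
          simp [map_add]
        have e : m * n - 1 = (m - 1) * (n - 1) + ((m - 1) + (n - 1)) := by noncomm_ring
        rw [e, h', h', h]
        noncomm_ring }

/-! ### Compact subgroups -/

/-- The subgroup `K_v = GL₂(O_v)` of `GL₂(F_v)`, for a finite place `v`. -/
def localMaxCompact (v : HeightOneSpectrum (𝓞 F)) :
    Subgroup (GL (Fin 2) (v.adicCompletion F)) :=
  (Matrix.GeneralLinearGroup.map
    (algebraMap (v.adicCompletionIntegers F) (v.adicCompletion F))).range

/-- The matrices of `GL₂(O_v)` whose lower left entry is in `𝔞 O_v`. -/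
def localKZero (v : HeightOneSpectrum (𝓞 F)) (𝔞 : Ideal (𝓞 F)) :
    Set (GL (Fin 2) (v.adicCompletion F)) :=
  {g | ∃ k : GL (Fin 2) (v.adicCompletionIntegers F),
    Matrix.GeneralLinearGroup.map
        (algebraMap (v.adicCompletionIntegers F) (v.adicCompletion F)) k = g ∧
      k 1 0 ∈ 𝔞.map (algebraMap (𝓞 F) (v.adicCompletionIntegers F))}

/-- `K₀(𝔞)`, the product over all finite places of the local groups, inside `GL₂` of the adeles
(so that all infinite components are `1`). -/
def KZero (𝔞 : Ideal (𝓞 F)) : Set (GLAdele F) :=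
  {g | (∀ w : InfinitePlace F, Matrix.GeneralLinearGroup.map (infiniteComponent w) g = 1) ∧
    ∀ v : HeightOneSpectrum (𝓞 F),
      Matrix.GeneralLinearGroup.map (finiteComponent v) g ∈ localKZero v 𝔞}

variable (F) in
/-- The standard maximal compact subgroup of `GL₂` of the adeles: `GL₂(O_v)` at the finite places,
the orthogonal or unitary group of size two at the infinite places. -/
def maxCompact : Subgroup (GLAdele F) :=
  (⨅ w : InfinitePlace F, (Matrix.unitaryGroup (Fin 2) ℂ).units.comap
    (Matrix.GeneralLinearGroup.map
      ((InfinitePlace.Completion.extensionEmbedding w).comp (infiniteComponent w)))) ⊓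
  (⨅ v : HeightOneSpectrum (𝓞 F), (localMaxCompact v).comap
    (Matrix.GeneralLinearGroup.map (finiteComponent v)))

/-! ### Unitary representations of `PGL₂` of the adeles -/

variable (F) in
/-- A (strongly continuous) unitary representation of `PGL₂` of the adeles on the space `H`, that
is, a unitary representation of `GL₂` on which the centre acts trivially. -/
structure UnitaryRep (H : Type*) [NormedAddCommGroup H] [InnerProductSpace ℂ H] where
  /-- The action. -/
  act : GLAdele F →* (H ≃ₗᵢ[ℂ] H)
  continuous_act : ∀ x : H, Continuous fun g => act g x
  act_center : ∀ z : (Adele F)ˣ, act (Matrix.GeneralLinearGroup.scalar (Fin 2) z) = 1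

namespace UnitaryRep

variable {H : Type*} [NormedAddCommGroup H] [InnerProductSpace ℂ H] (π : UnitaryRep F H)

/-- Invariant subspaces (not necessarily closed). -/
def IsInvariant (W : Submodule ℂ H) : Prop := ∀ g, ∀ x ∈ W, π.act g x ∈ W

/-- Topological irreducibility. -/
def IsIrreducible : Prop :=
  Nontrivial H ∧ ∀ W : Submodule ℂ H, IsClosed (W : Set H) → π.IsInvariant W → W = ⊥ ∨ W = ⊤

/-- The action on an invariant subspace. -/
def actOn {V : Submodule ℂ H} (hV : π.IsInvariant V) (g : GLAdele F) (x : V) : V :=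
  ⟨π.act g x, hV g x x.2⟩

/-- The vectors fixed by a set of group elements. -/
def fixedBy (S : Set (GLAdele F)) : Submodule ℂ H where
  carrier := {x | ∀ g ∈ S, π.act g x = x}
  zero_mem' := fun g _ => map_zero _
  add_mem' := fun hx hy g hg => by rw [map_add, hx g hg, hy g hg]
  smul_mem' := fun c x hx g hg => by rw [map_smul, hx g hg]

/-- `𝔠` is the (finite) conductor of `π`: the largest nonzero ideal `𝔞` such that `π` has nonzero
`K₀(𝔞)`-invariant vectors, i.e. there are such vectors for `𝔞` exactly when `𝔠` divides `𝔞`. -/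
def HasConductor (𝔠 : Ideal (𝓞 F)) : Prop :=
  𝔠 ≠ ⊥ ∧ ∀ 𝔞 : Ideal (𝓞 F), 𝔞 ≠ ⊥ → (π.fixedBy (KZero 𝔞) ≠ ⊥ ↔ 𝔠 ∣ 𝔞)

end UnitaryRep

/-! ### Unitary automorphic representations -/

variable (F) in
/-- The subgroup `Z(𝔸) GL₂(F)` of `GL₂(𝔸)`. -/
def rationalSubgroup : Subgroup (GLAdele F) :=
  (Matrix.GeneralLinearGroup.scalar (Fin 2) : (Adele F)ˣ →* GLAdele F).range ⊔
    (Matrix.GeneralLinearGroup.map (algebraMap F (Adele F)) : GL (Fin 2) F →* GLAdele F).range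

variable (F) in
/-- The automorphic quotient. The space `Z(𝔸) GL₂(F) \ GL₂(𝔸)`, with its action by right
translation, is written as the space of cosets `g Z(𝔸) GL₂(F)` by means of `g ↦ g⁻¹`; the right
translation `x ↦ x h` then becomes `x ↦ h⁻¹ • x`. -/
def AutQuotient : Type _ := GLAdele F ⧸ rationalSubgroup F

instance : TopologicalSpace (AutQuotient F) :=
  inferInstanceAs (TopologicalSpace (GLAdele F ⧸ rationalSubgroup F))
instance : MulAction (GLAdele F) (AutQuotient F) :=
  inferInstanceAs (MulAction (GLAdele F) (GLAdele F ⧸ rationalSubgroup F))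
instance : ContinuousConstSMul (GLAdele F) (AutQuotient F) :=
  inferInstanceAs (ContinuousConstSMul (GLAdele F) (GLAdele F ⧸ rationalSubgroup F))
instance : MeasurableSpace (AutQuotient F) := borel _
instance : BorelSpace (AutQuotient F) := ⟨rfl⟩

/-- The class `Z(𝔸) GL₂(F) g`. -/
def toQuotient (g : GLAdele F) : AutQuotient F := QuotientGroup.mk g⁻¹

/-- Right translation on the Hilbert space `L²` of the automorphic quotient:
`(rightTranslation h f)(x) = f (x h)`. -/
def rightTranslation {m : Measure (AutQuotient F)} [SMulInvariantMeasure (GLAdele F) (AutQuotient F) m]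
    (h : GLAdele F) (f : Lp ℂ 2 m) : Lp ℂ 2 m :=
  DomMulAct.mk h⁻¹ • f

/-- Cuspidality of an element `f` of `L²` of the automorphic quotient: the integral over
`x ∈ F \ 𝔸` of `f (n(x) g)` vanishes for almost every `g`. -/
def IsCuspidalFunction {m : Measure (AutQuotient F)} (f : Lp ℂ 2 m) : Prop :=
  ∀ (haarG : Measure (GLAdele F)) (haarA : Measure (Adele F)) (D : Set (Adele F)),
    haarG.IsHaarMeasure → haarA.IsAddHaarMeasure →
    IsAddFundamentalDomain (AdeleRing.principalSubgroup (𝓞 F) F) D haarA →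
      ∀ᵐ g ∂haarG,
        ∫ x in D, f (toQuotient (Matrix.GeneralLinearGroup.upperRightHom x * g)) ∂haarA = 0

/-- The adelic absolute value of an idele. -/
def ideleAbs (a : (Adele F)ˣ) : ℝ :=
  (∏ w : InfinitePlace F, ‖infiniteComponent w (a : Adele F)‖ ^ w.mult) *
    ∏ᶠ v : HeightOneSpectrum (𝓞 F), ‖finiteComponent v (a : Adele F)‖

/-- The continuous functions of the principal series `χ ⊞ χ⁻¹`: `f (b g)` equals
`χ(a) χ(d)⁻¹ |a / d|^(1/2) f(g)` for every upper triangular `b` with diagonal `(a, d)`. -/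
def principalSeries (χ : (Adele F)ˣ →* Circle) : Submodule ℂ (GLAdele F → ℂ) where
  carrier := {f | Continuous f ∧ ∀ (b g : GLAdele F) (a d : (Adele F)ˣ),
    b 0 0 = a → b 1 1 = d → b 1 0 = 0 →
      f (b * g) = (χ a : ℂ) * ((χ d)⁻¹ : Circle) * (√(ideleAbs (a / d)) : ℝ) * f g}
  zero_mem' := ⟨continuous_const, fun _ _ _ _ _ _ _ => (mul_zero _).symm⟩
  add_mem' := fun {f₁ f₂} h₁ h₂ => ⟨h₁.1.add h₂.1, fun b g a d h h' h'' => by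
    simp only [Pi.add_apply]
    rw [h₁.2 b g a d h h' h'', h₂.2 b g a d h h' h'', mul_add]⟩
  smul_mem' := fun c f hf => ⟨hf.1.const_smul c, fun b g a d h h' h'' => by
    simp only [Pi.smul_apply, smul_eq_mul]
    rw [hf.2 b g a d h h' h'']
    ring⟩

namespace UnitaryRep

variable {H : Type*} [NormedAddCommGroup H] [InnerProductSpace ℂ H] (π : UnitaryRep F H)

/-- `π` is (isomorphic to) a closed subrepresentation of the cuspidal part of `L²` of the automorphic
quotient, for the finite invariant measure `m`, which is unique up to scaling. -/
def OccursInCuspidal : Prop :=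
  ∃ (m : Measure (AutQuotient F)) (_ : SMulInvariantMeasure (GLAdele F) (AutQuotient F) m)
    (J : H →ₗᵢ[ℂ] Lp ℂ 2 m),
    IsFiniteMeasure m ∧ m ≠ 0 ∧
      (∀ g x, J (π.act g x) = rightTranslation g (J x)) ∧ ∀ x, IsCuspidalFunction (J x)

/-- `π` is an Eisenstein representation, one of the constituents of the continuous spectrum:
it is (isomorphic to) the principal series `χ ⊞ χ⁻¹` of a unitary character `χ` of `Fˣ \ 𝔸ˣ`, i.e.
the Hilbert space completion of the space of continuous sections, with right translation, for
the norm whose square is the integral of `|f|²` over the maximal compact subgroup. -/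
def IsEisenstein : Prop :=
  ∃ χ : (Adele F)ˣ →* Circle, Continuous χ ∧
    (∀ x : Fˣ, χ (Units.map (algebraMap F (Adele F)).toMonoidHom x) = 1) ∧
    ∃ (ν : Measure (maxCompact F)) (J : principalSeries χ →ₗ[ℂ] H),
      IsProbabilityMeasure ν ∧ ν.IsMulLeftInvariant ∧
      (∀ f, ‖J f‖ ^ 2 = ∫ k, ‖(f : GLAdele F → ℂ) k‖ ^ 2 ∂ν) ∧
      DenseRange J ∧
      ∀ (g : GLAdele F) (f f' : principalSeries χ),
        (∀ x, (f' : GLAdele F → ℂ) x = (f : GLAdele F → ℂ) (x * g)) → J f' = π.act g (J f)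

/-- Unitary automorphic representations of `PGL₂`: the irreducible representations which are
cuspidal or Eisenstein. -/
def IsUnitaryAutomorphic : Prop :=
  π.IsIrreducible ∧ (π.OccursInCuspidal ∨ π.IsEisenstein)

end UnitaryRep

/-! ### Hecke operators and translates -/

/-- Uniformizers of `F_v`. -/
def IsUniformizer {v : HeightOneSpectrum (𝓞 F)} (ϖ : (v.adicCompletion F)ˣ) : Prop :=
  Valued.v (ϖ : v.adicCompletion F) = WithZero.exp (-1 : ℤ)

/-- The local matrix with rows `(a, 0)` and `(0, d)`. -/
def diagMatrix {v : HeightOneSpectrum (𝓞 F)} (a d : (v.adicCompletion F)ˣ) :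
    GL (Fin 2) (v.adicCompletion F) :=
  Matrix.GeneralLinearGroup.mkOfDetNeZero !![(a : v.adicCompletion F), 0; 0, d] (by simp)

/-- The local matrix with rows `(0, -1)` and `(ϖ, 0)`. -/
def atkinLehnerMatrix {v : HeightOneSpectrum (𝓞 F)} (ϖ : (v.adicCompletion F)ˣ) :
    GL (Fin 2) (v.adicCompletion F) :=
  Matrix.GeneralLinearGroup.mkOfDetNeZero !![0, -1; (ϖ : v.adicCompletion F), 0] (by simp)

/-- The adelic matrix with component `diag(1, ϖ)` at `v` and `1` elsewhere. -/
def shift {v : HeightOneSpectrum (𝓞 F)} (ϖ : (v.adicCompletion F)ˣ) : GLAdele F :=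
  localInclusion v (diagMatrix 1 ϖ)

/-- The double coset `K_v diag(ϖ, 1) K_v` (for one, equivalently for every, uniformizer `ϖ`). -/
def heckeSet (v : HeightOneSpectrum (𝓞 F)) : Set (GL (Fin 2) (v.adicCompletion F)) :=
  {h | ∃ ϖ : (v.adicCompletion F)ˣ, IsUniformizer ϖ ∧
    ∃ k₁ ∈ localMaxCompact v, ∃ k₂ ∈ localMaxCompact v, h = k₁ * diagMatrix ϖ 1 * k₂}

namespace UnitaryRep

variable {H : Type*} [NormedAddCommGroup H] [InnerProductSpace ℂ H] (π : UnitaryRep F H)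

/-- The Hecke operator at `v`, for the Haar measure `μ` on `GL₂(F_v)` (to be normalized by
`μ (K_v) = 1`): the integral of the translates of `x` over the double coset of `diag(ϖ, 1)`,
divided by the square root of the size of the residue field. -/
def hecke (v : HeightOneSpectrum (𝓞 F)) (μ : Measure (GL (Fin 2) (v.adicCompletion F)))
    (x : H) : H :=
  (1 / √(Ideal.absNorm v.asIdeal : ℝ)) • ∫ h in heckeSet v, π.act (localInclusion v h) x ∂μ

/-- The image of `K_v` in `GL₂` of the adeles fixes `x`. -/
def IsSpherical (v : HeightOneSpectrum (𝓞 F)) (x : H) : Prop :=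
  x ∈ π.fixedBy (localInclusion v '' localMaxCompact v)

end UnitaryRep

end PGLTwo

end

/-!
The argument rests on Schur's lemma, in the form `exists_eq_smul_of_compression_commute`: for an
irreducible unitary representation and a closed subspace `E`, an operator `T` on `E` is a real
scalar as soon as `⟨y, g T x⟩ = ⟨T y, g x⟩` for all `x`, `y` in `E` and all `g` in the group. In the
adelic group one writes `g = a b` with `a` in `GL₂(F_v)` and `b` trivial at `v`, and moves `b` to
`y`, so that only an identity between matrix coefficients of the local group has to be shown. The
factorization of automorphic representations into local ones is not needed.

For the Hecke operator at `𝔭`, the space `E` consists of the vectors fixed by `K_𝔭`. The integral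
over the double coset `K_𝔭 diag(ϖ, 1) K_𝔭` is a sum over `p + 1` cosets of `K_𝔭`, and the identity
follows from Gelfand's trick: by the Cartan decomposition each double coset of `K_𝔭` is stable under
inversion up to the centre (`exists_inv_eq`), so that `f g⁻¹ = f g` for matrix coefficients `f`
of vectors in `E`, and the spherical Hecke algebra is commutative (`sum_heckeRep_comm`).

For the Atkin–Lehner matrix `u` at `𝔮`, the space `E` consists of the vectors of level `𝔮`. The
Iwahori–Hecke algebra is not commutative, but since the conductor is `𝔮` there are no vectors of
level one, so the trace of `x` in `E` to level one vanishes (`sum_iwahoriRep_eq_zero`). By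
induction along the Bruhat decomposition (`atkinLehner_induction`), every matrix coefficient
`⟨y, a x⟩`, with `a` local at `𝔮` and `y` fixed by the Iwahori subgroup, is then a multiple of
some `⟨y, u ^ n x⟩`, by a factor which only depends on `a` (`exists_inner_localAct_eq`). So `u`
commutes with all compressions and is a scalar, and its square is `1` because `u ^ 2` is central.

The identities for an invariant trilinear functional come from translating its three arguments
simultaneously (`hecke_trilinear`, `atkinLehner_trilinear`). With `t = diag(1, ϖ)` and `w` the Weyl
element, `t w t` is a scalar times `w`. Hence translation by `r t w`, with `r` in `K_𝔭`, turns the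
vectors shifted by `t` into the unshifted ones and `φ` into `r t φ`. These are the `p + 1` terms of
the Hecke operator. The case of `u = t w` is similar.
-/

noncomputable section

namespace PGLTwo

/-! ### Schur's lemma for symmetric operators -/

section Schur

/-- A bounded self-adjoint operator is a real scalar if all elements of its bicommutant are either
zero or injective: two points of its spectrum could be separated by two continuous functions
with product zero, which would give two nonzero elements of the bicommutant with product zero. -/
theorem exists_eq_smul_of_bicommutant_injective {E : Type*} [NormedAddCommGroup E]
    [InnerProductSpace ℂ E] [CompleteSpace E] (T : E →L[ℂ] E) (hT : IsSelfAdjoint T)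
    (h : ∀ A : E →L[ℂ] E, (∀ B, Commute T B → Commute A B) → A = 0 ∨ ∀ x, A x = 0 → x = 0) :
    ∃ c : ℝ, ∀ x, T x = c • x := by
  rcases subsingleton_or_nontrivial E with hE | hE
  · exact ⟨0, fun x => Subsingleton.elim _ _⟩
  have hsub : (spectrum ℝ T).Subsingleton := by
    by_contra hcon
    rw [Set.not_subsingleton_iff] at hcon
    obtain ⟨a, ha, b, hb, hab⟩ := hcon.exists_lt
    have hfne : ∀ (f : ℝ → ℝ), Continuous f → ∀ t ∈ spectrum ℝ T, f t ≠ 0 → cfc f T ≠ 0 := by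
      intro f hf t ht hne h0
      refine hne ?_
      have := (cfc_eq_cfc_iff_eqOn (R := ℝ) (a := T) (f := f) (g := fun _ => 0) hT
        hf.continuousOn continuousOn_const).1 (by rw [h0, cfc_const_zero])
      exact this ht
    let f₁ : ℝ → ℝ := fun x => max 0 (x - (a + b) / 2)
    let f₂ : ℝ → ℝ := fun x => max 0 ((a + b) / 2 - x)
    have h₁ : Continuous f₁ := by fun_prop
    have h₂ : Continuous f₂ := by fun_prop
    have n₁ : cfc f₁ T ≠ 0 := hfne f₁ h₁ b hb (lt_max_of_lt_right (by linarith)).ne'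
    have n₂ : cfc f₂ T ≠ 0 := hfne f₂ h₂ a ha (lt_max_of_lt_right (by linarith)).ne'
    have hprod : cfc f₁ T * cfc f₂ T = 0 := by
      rw [← cfc_mul f₁ f₂ T h₁.continuousOn h₂.continuousOn, ← cfc_const_zero ℝ T]
      congr 1
      funext x
      rcases le_total x ((a + b) / 2) with hx | hx
      · simp [f₁, hx]
      · simp [f₂, hx]
    refine n₂ (ContinuousLinearMap.ext fun x => ?_)
    exact ((h _ fun B hB => hB.cfc_real f₁).resolve_left n₁) _ (by simpa using congr($hprod x))
  obtain ⟨c, hc⟩ := ContinuousFunctionalCalculus.spectrum_nonempty (R := ℝ) T hT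
  refine ⟨c, fun x => ?_⟩
  have : T = cfc (fun _ => c) T := by
    conv_lhs => rw [← cfc_id ℝ T]
    exact cfc_congr fun t ht => hsub ht hc
  rw [cfc_const c T] at this
  conv_lhs => rw [this]
  rw [Algebra.algebraMap_eq_smul_one]
  simp

variable {G H : Type*} [Group G] [NormedAddCommGroup H] [InnerProductSpace ℂ H] [CompleteSpace H]

/-- Schur's lemma on a corner. Let `G` act unitarily and irreducibly on `H`, and let `E` be a closed
subspace. The hypothesis `hTg` says that `T` is symmetric on `E` and commutes with all the
compressions to `E` of elements of `G`. The kernel `M` of a function of `T` is then stable under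
these compressions, so that the vectors all of whose translates project into `M` form a closed
invariant subspace of `H`, which contains `M`, and contains `E` only if `M = E`. -/
theorem exists_eq_smul_of_compression_commute (act : G →* (H ≃ₗᵢ[ℂ] H))
    (hirr : ∀ W : Submodule ℂ H, IsClosed (W : Set H) → (∀ g, ∀ x ∈ W, act g x ∈ W) →
      W = ⊥ ∨ W = ⊤)
    (E : Submodule ℂ H) (hE : IsClosed (E : Set H)) (T : E →ₗ[ℂ] E)
    (hTg : ∀ (g : G) (x y : E), inner ℂ (y : H) (act g (T x)) = inner ℂ (T y : H) (act g x)) :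
    ∃ c : ℝ, ∀ x, T x = c • x := by
  have : CompleteSpace E := hE.completeSpace_coe
  have hsymm : T.IsSymmetric := fun x y => by simpa using (hTg 1 y x).symm
  let T' : E →L[ℂ] E := ⟨T, hsymm.continuous⟩
  have hself : IsSelfAdjoint T' := ContinuousLinearMap.isSelfAdjoint_iff_isSymmetric.2 hsymm
  let B : G → E →L[ℂ] E := fun g =>
    E.orthogonalProjectionOnto ∘L (act g).toContinuousLinearEquiv.toContinuousLinearMap ∘L
      E.subtypeL
  have hB : ∀ g (x y : E), inner ℂ y (B g x) = inner ℂ (y : H) (act g x) := fun g x y => by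
    simp [B]
  have hcomm : ∀ g, Commute T' (B g) := fun g => by
    refine ContinuousLinearMap.ext fun x => ext_inner_left ℂ fun y => ?_
    have e : inner ℂ y (T' (B g x)) = inner ℂ (T' y) (B g x) := (hsymm _ _).symm
    simp only [mul_apply_eq_comp, e, hB]
    exact (hTg g x y).symm
  refine exists_eq_smul_of_bicommutant_injective T' hself fun A hAT => ?_
  have hA : ∀ g x, A (B g x) = B g (A x) := fun g x =>
    congr($(hAT _ (hcomm g)) x)
  let W : Submodule ℂ H :=
    { carrier := {x | ∀ g, A (E.orthogonalProjectionOnto (act g x)) = 0}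
      zero_mem' := fun g => by simp
      add_mem' := fun hx hy g => by simp [hx g, hy g]
      smul_mem' := fun c x hx g => by simp [hx g] }
  have hWcl : IsClosed (W : Set H) := by
    have : (W : Set H) = ⋂ g, {x | A (E.orthogonalProjectionOnto (act g x)) = 0} := by
      ext x
      simp [W]
    rw [this]
    refine isClosed_iInter fun g => isClosed_eq ?_ continuous_const
    exact A.continuous.comp (E.orthogonalProjectionOnto.continuous.comp (act g).continuous)
  have hWinv : ∀ g, ∀ x ∈ W, act g x ∈ W := fun g x hx h => by
    simpa [map_mul] using hx (h * g)
  rcases hirr W hWcl hWinv with hW | hW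
  · refine Or.inr fun x hx => ?_
    have hxW : (x : H) ∈ W := fun g => by
      have : A (B g x) = 0 := by rw [hA, show A x = 0 from hx, map_zero]
      exact this
    rw [hW] at hxW
    exact Subtype.ext hxW
  · refine Or.inl (ContinuousLinearMap.ext fun x => ?_)
    have hxW : (x : H) ∈ W := hW ▸ Submodule.mem_top
    simpa using hxW 1

end Schur

/-! ### Systems of representatives of cosets -/

section Transversal

variable {G ι M : Type*} [Group G] [AddCommMonoid M]

/-- The elements `r i` of `S` represent the left cosets `s L`, for `s ∈ S`, once each. -/
def IsLeftTransversal (r : ι → G) (S : Set G) (L : Subgroup G) : Prop :=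
  (∀ i, r i ∈ S) ∧ ∀ s ∈ S, ∃! i, (r i)⁻¹ * s ∈ L

/-- A sum over left cosets does not change under a left translation which preserves the set of
cosets. -/
theorem IsLeftTransversal.sum_mul_left [Fintype ι] {r : ι → G} {S : Set G} {L : Subgroup G}
    (hr : IsLeftTransversal r S L) {k : G} (hk : ∀ s ∈ S, k * s ∈ S) (f : G → M)
    (hf : ∀ g, ∀ l ∈ L, f (g * l) = f g) :
    ∑ i, f (k * r i) = ∑ i, f (r i) := by
  choose σ hσ using fun i => (hr.2 _ (hk _ (hr.1 i))).exists
  have hinj : Function.Injective σ := fun i j hij => by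
    refine (hr.2 _ (hr.1 j)).unique ?_ (by simp [L.one_mem])
    have := L.mul_mem (L.inv_mem (hσ i)) (hij ▸ hσ j)
    simpa [mul_assoc] using this
  refine Fintype.sum_bijective σ (Finite.injective_iff_bijective.1 hinj) _ _ fun i => ?_
  rw [← hf (r (σ i)) _ (hσ i)]
  simp

end Transversal

/-! ### Elements and subgroups of the local group -/

section Local

open Matrix.GeneralLinearGroup (scalar mkOfDetNeZero)

variable {F : Type*} [Field F] [NumberField F] {v : HeightOneSpectrum (𝓞 F)}

/-- The local group `GL₂(F_v)`. -/
abbrev GLLocal (v : HeightOneSpectrum (𝓞 F)) : Type _ := GL (Fin 2) (v.adicCompletion F)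

/-- The local matrix with rows `(1, t)` and `(0, 1)`. -/
def upperUnip (t : v.adicCompletion F) : GLLocal v := mkOfDetNeZero !![1, t; 0, 1] (by simp)

/-- The local matrix with rows `(1, 0)` and `(t, 1)`. -/
def lowerUnip (t : v.adicCompletion F) : GLLocal v := mkOfDetNeZero !![1, 0; t, 1] (by simp)

variable (v) in
/-- The local matrix with rows `(0, -1)` and `(1, 0)`. -/
def weyl : GLLocal v := mkOfDetNeZero !![0, -1; 1, 0] (by simp)

@[simp] theorem coe_upperUnip (t : v.adicCompletion F) :
    (upperUnip t : Matrix (Fin 2) (Fin 2) (v.adicCompletion F)) = !![1, t; 0, 1] := rfl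
@[simp] theorem coe_lowerUnip (t : v.adicCompletion F) :
    (lowerUnip t : Matrix (Fin 2) (Fin 2) (v.adicCompletion F)) = !![1, 0; t, 1] := rfl
@[simp] theorem coe_weyl :
    (weyl v : Matrix (Fin 2) (Fin 2) (v.adicCompletion F)) = !![0, -1; 1, 0] := rfl
@[simp] theorem coe_diagMatrix (a d : (v.adicCompletion F)ˣ) :
    (diagMatrix a d : Matrix (Fin 2) (Fin 2) (v.adicCompletion F)) =
      !![(a : v.adicCompletion F), 0; 0, d] := rfl
@[simp] theorem coe_atkinLehnerMatrix (ϖ : (v.adicCompletion F)ˣ) :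
    (atkinLehnerMatrix ϖ : Matrix (Fin 2) (Fin 2) (v.adicCompletion F)) =
      !![0, -1; (ϖ : v.adicCompletion F), 0] := rfl
@[simp] theorem coe_scalar_fin_two (a : (v.adicCompletion F)ˣ) :
    (scalar (Fin 2) a : Matrix (Fin 2) (Fin 2) (v.adicCompletion F)) =
      !![(a : v.adicCompletion F), 0; 0, a] := by
  ext i j
  fin_cases i <;> fin_cases j <;> simp

theorem localGL_ext {g h : GLLocal v}
    (e : (g : Matrix (Fin 2) (Fin 2) (v.adicCompletion F)) = h) : g = h := Units.ext e

theorem inv_apply_fin_two (g : GLLocal v) :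
    ((g⁻¹ : GLLocal v) : Matrix (Fin 2) (Fin 2) (v.adicCompletion F)) =
      (g : Matrix (Fin 2) (Fin 2) (v.adicCompletion F)).det⁻¹ •
        !![g 1 1, -g 0 1; -g 1 0, g 0 0] := by
  rw [Matrix.GeneralLinearGroup.coe_inv, Matrix.inv_def, Matrix.adjugate_fin_two,
    Ring.inverse_eq_inv']

theorem det_apply_ne_zero (g : GLLocal v) : g 0 0 * g 1 1 - g 0 1 * g 1 0 ≠ 0 := by
  have h := (Matrix.GeneralLinearGroup.det g).ne_zero
  rwa [Matrix.GeneralLinearGroup.val_det_apply, Matrix.det_fin_two] at h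

theorem mem_localMaxCompact_iff {g : GLLocal v} :
    g ∈ localMaxCompact v ↔ (∀ i j, Valued.v (g i j) ≤ 1) ∧
      Valued.v (g : Matrix (Fin 2) (Fin 2) (v.adicCompletion F)).det = 1 := by
  constructor
  · rintro ⟨k, rfl⟩
    refine ⟨fun i j => (k i j).2, ?_⟩
    have h := (Matrix.GeneralLinearGroup.det k).isUnit
    rw [HeightOneSpectrum.adicCompletionIntegers.isUnit_iff_valued_eq_one] at h
    rw [← h, ← Matrix.GeneralLinearGroup.val_det_apply, Matrix.GeneralLinearGroup.map_det]
    rfl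
  · rintro ⟨h, hdet⟩
    let k : Matrix (Fin 2) (Fin 2) (v.adicCompletionIntegers F) := fun i j => ⟨g i j, h i j⟩
    have hk : (algebraMap (v.adicCompletionIntegers F) (v.adicCompletion F)).mapMatrix k = g := by
      ext i j
      rfl
    have hu : IsUnit k.det := by
      rw [HeightOneSpectrum.adicCompletionIntegers.isUnit_iff_valued_eq_one, ← hdet, ← hk,
        ← RingHom.map_det]
      rfl
    refine ⟨Matrix.GeneralLinearGroup.mk'' k hu, localGL_ext ?_⟩
    ext i j
    rfl

variable (v) in
/-- The Iwahori subgroup of `GL₂(F_v)`, the group of matrices in `GL₂(O_v)` which are upper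
triangular modulo the maximal ideal. -/
def iwahori : Subgroup (GLLocal v) where
  carrier := {g | g ∈ localMaxCompact v ∧ Valued.v (g 1 0) < 1}
  one_mem' := ⟨Subgroup.one_mem _, by simp⟩
  mul_mem' := by
    rintro g h ⟨hg, hg'⟩ ⟨hh, hh'⟩
    refine ⟨Subgroup.mul_mem _ hg hh, ?_⟩
    have e : (g * h) 1 0 = g 1 0 * h 0 0 + g 1 1 * h 1 0 := by
      simp [Matrix.mul_apply]
    rw [e]
    rw [mem_localMaxCompact_iff] at hg hh
    refine (Valuation.map_add_lt _ ?_ ?_)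
    · rw [map_mul]
      exact mul_lt_one_of_nonneg_of_lt_one_left zero_le hg' (hh.1 0 0)
    · rw [map_mul]
      exact mul_lt_one_of_nonneg_of_lt_one_right (hg.1 1 1) zero_le hh'
  inv_mem' := by
    rintro g ⟨hg, hg'⟩
    refine ⟨Subgroup.inv_mem _ hg, ?_⟩
    rw [inv_apply_fin_two]
    rw [mem_localMaxCompact_iff] at hg
    simpa [hg.2] using hg'

theorem mem_iwahori_iff {g : GLLocal v} :
    g ∈ iwahori v ↔ g ∈ localMaxCompact v ∧ Valued.v (g 1 0) < 1 := Iff.rfl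

theorem iwahori_le : iwahori v ≤ localMaxCompact v := fun _ h => h.1

theorem upperUnip_mem {t : v.adicCompletion F} (ht : Valued.v t ≤ 1) : upperUnip t ∈ iwahori v := by
  simp [mem_iwahori_iff, mem_localMaxCompact_iff, Fin.forall_fin_two, ht]

theorem lowerUnip_mem {t : v.adicCompletion F} (ht : Valued.v t < 1) : lowerUnip t ∈ iwahori v := by
  simp [mem_iwahori_iff, mem_localMaxCompact_iff, Fin.forall_fin_two, ht, ht.le]

theorem diagMatrix_mem {a d : (v.adicCompletion F)ˣ}
    (ha : Valued.v (a : v.adicCompletion F) = 1) (hd : Valued.v (d : v.adicCompletion F) = 1) :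
    diagMatrix a d ∈ iwahori v := by
  simp [mem_iwahori_iff, mem_localMaxCompact_iff, Fin.forall_fin_two, ha, hd]

theorem weyl_mem : weyl v ∈ localMaxCompact v := by
  simp [mem_localMaxCompact_iff, Fin.forall_fin_two]

theorem weyl_mul_diagMatrix (a d : (v.adicCompletion F)ˣ) :
    weyl v * diagMatrix a d = diagMatrix d a * weyl v := by
  apply localGL_ext
  simp

theorem diagMatrix_mul_diagMatrix (a b c d : (v.adicCompletion F)ˣ) :
    diagMatrix a b * diagMatrix c d = diagMatrix (a * c) (b * d) := by
  apply localGL_ext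
  simp

theorem diagMatrix_mul_diagMatrix_swap (a d : (v.adicCompletion F)ˣ) :
    diagMatrix a d * diagMatrix d a = scalar (Fin 2) (a * d) := by
  apply localGL_ext
  rw [coe_scalar_fin_two]
  simp [mul_comm]

/-! ### The Bruhat and Cartan decompositions -/

/-- An induction principle which amounts to the Bruhat decomposition of `GL₂(F_v)` with respect to
the Iwahori subgroup: the double cosets are represented by diagonal and antidiagonal matrices. -/
theorem bruhat_induction {p : GLLocal v → Prop}
    (hl : ∀ k ∈ iwahori v, ∀ g, p (k * g) → p g) (hr : ∀ k ∈ iwahori v, ∀ g, p (g * k) → p g)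
    (hdiag : ∀ a d : (v.adicCompletion F)ˣ, p (diagMatrix a d))
    (hanti : ∀ a d : (v.adicCompletion F)ˣ, p (diagMatrix a d * weyl v)) (g : GLLocal v) : p g := by
  have hdiv : ∀ {x y : v.adicCompletion F}, Valued.v x ≤ Valued.v y → Valued.v (-x / y) ≤ 1 := by
    intro x y h
    rw [map_div₀, Valuation.map_neg]
    exact div_le_one_of_le₀ h zero_le
  have hdiv' : ∀ {x y : v.adicCompletion F}, Valued.v x < Valued.v y → Valued.v (-x / y) < 1 := by
    intro x y h
    rw [map_div₀, Valuation.map_neg]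
    exact (div_lt_one₀ (zero_le.trans_lt h)).2 h
  -- Successively more general shapes of `g` are brought into the previous ones by row and column
  -- operations from the Iwahori group, the pivot being determined by the valuations of the entries.
  have hD : ∀ g : GLLocal v, g 0 1 = 0 → g 1 0 = 0 → p g := by
    intro g h01 h10
    have hdet := det_apply_ne_zero g
    rw [h01, zero_mul, sub_zero] at hdet
    convert! hdiag (Units.mk0 _ (left_ne_zero_of_mul hdet))
      (Units.mk0 _ (right_ne_zero_of_mul hdet)) using 1
    apply localGL_ext
    ext i j
    fin_cases i <;> fin_cases j <;> simp [h01, h10]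
  have hA : ∀ g : GLLocal v, g 0 0 = 0 → g 1 1 = 0 → p g := by
    intro g h00 h11
    have hdet := det_apply_ne_zero g
    rw [h00, zero_mul, zero_sub, neg_ne_zero] at hdet
    convert! hanti (Units.mk0 _ (neg_ne_zero.2 (left_ne_zero_of_mul hdet)))
      (Units.mk0 _ (right_ne_zero_of_mul hdet)) using 1
    apply localGL_ext
    ext i j
    fin_cases i <;> fin_cases j <;> simp [h00, h11]
  have hU : ∀ g : GLLocal v, g 1 0 = 0 → p g := by
    intro g h10
    have hdet := det_apply_ne_zero g
    rw [h10, mul_zero, sub_zero] at hdet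
    have h0 := left_ne_zero_of_mul hdet
    have h1 := right_ne_zero_of_mul hdet
    rcases le_or_gt (Valued.v (g 0 1)) (Valued.v (g 0 0)) with h | h
    · refine hr _ (upperUnip_mem (hdiv h)) _ (hD _ ?_ ?_)
      · simp [Matrix.mul_apply]
        field_simp
        ring
      · simp [Matrix.mul_apply, h10]
    rcases le_or_gt (Valued.v (g 0 1)) (Valued.v (g 1 1)) with h' | h'
    · refine hl _ (upperUnip_mem (hdiv h')) _ (hD _ ?_ ?_)
      · simp [Matrix.mul_apply]
        field_simp
        ring
      · simp [Matrix.mul_apply, h10]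
    have h2 : g 0 1 ≠ 0 := fun h0 => by simp [h0] at h
    refine hr _ (lowerUnip_mem (hdiv' h)) _ (hl _ (lowerUnip_mem (hdiv' h')) _ (hA _ ?_ ?_))
    · simp [Matrix.mul_apply]
      field_simp
      ring
    · simp [Matrix.mul_apply]
      field_simp
      simp
  have hL : ∀ g : GLLocal v, g 0 0 = 0 → p g := by
    intro g h00
    have hdet := det_apply_ne_zero g
    rw [h00, zero_mul, zero_sub, neg_ne_zero] at hdet
    have h0 := left_ne_zero_of_mul hdet
    have h1 := right_ne_zero_of_mul hdet
    rcases le_or_gt (Valued.v (g 1 1)) (Valued.v (g 1 0)) with h | h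
    · refine hr _ (upperUnip_mem (hdiv h)) _ (hA _ ?_ ?_)
      · simp [Matrix.mul_apply, h00]
      · simp [Matrix.mul_apply]
        field_simp
        ring
    rcases lt_or_ge (Valued.v (g 1 1)) (Valued.v (g 0 1)) with h' | h'
    · refine hl _ (lowerUnip_mem (hdiv' h')) _ (hA _ ?_ ?_)
      · simp [Matrix.mul_apply, h00]
      · simp [Matrix.mul_apply]
        field_simp
        ring
    have h2 : g 1 1 ≠ 0 := fun h0 => by simp [h0] at h
    refine hr _ (lowerUnip_mem (hdiv' h)) _ (hl _ (upperUnip_mem (hdiv h')) _ (hD _ ?_ ?_))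
    · simp [Matrix.mul_apply]
      field_simp
      ring
    · simp [Matrix.mul_apply]
      field_simp
      ring
  rcases lt_or_ge (Valued.v (g 1 0)) (Valued.v (g 0 0)) with h | h
  · have h2 : g 0 0 ≠ 0 := fun h0 => by simp [h0] at h
    refine hl _ (lowerUnip_mem (hdiv' h)) _ (hU _ ?_)
    simp [Matrix.mul_apply]
    field_simp
    ring
  · refine hl _ (upperUnip_mem (hdiv h)) _ (hL _ ?_)
    by_cases h2 : g 1 0 = 0
    · have : g 0 0 = 0 := by simpa [h2] using h
      simp [Matrix.mul_apply, h2, this]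
    · simp [Matrix.mul_apply]
      field_simp
      ring

/-- Every double coset of `K_v` is stable under inversion, up to the centre: by the Cartan
decomposition this only has to be checked for diagonal matrices. -/
theorem exists_inv_eq (g : GLLocal v) : ∃ k ∈ localMaxCompact v, ∃ k' ∈ localMaxCompact v,
    ∃ z : (v.adicCompletion F)ˣ, g⁻¹ = scalar (Fin 2) z * (k * g * k') := by
  have hdiag : ∀ a d : (v.adicCompletion F)ˣ, (diagMatrix a d)⁻¹ =
      scalar (Fin 2) (a * d)⁻¹ * (weyl v * diagMatrix a d * (weyl v)⁻¹) := by
    intro a d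
    rw [weyl_mul_diagMatrix, mul_inv_cancel_right]
    refine inv_eq_of_mul_eq_one_right ?_
    rw [← mul_assoc, ← Matrix.GeneralLinearGroup.scalar_commute, mul_assoc,
      diagMatrix_mul_diagMatrix_swap, ← map_mul, inv_mul_cancel, map_one]
  induction g using bruhat_induction with
  | hl k₀ hk₀ g ih =>
    obtain ⟨k, hk, k', hk', z, e⟩ := ih
    have hk₀ := iwahori_le hk₀
    refine ⟨k * k₀, mul_mem hk hk₀, k' * k₀, mul_mem hk' hk₀, z, ?_⟩
    rw [mul_inv_rev, mul_inv_eq_iff_eq_mul] at e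
    rw [e]
    simp only [mul_assoc]
  | hr k₀ hk₀ g ih =>
    obtain ⟨k, hk, k', hk', z, e⟩ := ih
    have hk₀ := iwahori_le hk₀
    refine ⟨k₀ * k, mul_mem hk₀ hk, k₀ * k', mul_mem hk₀ hk', z, ?_⟩
    rw [mul_inv_rev, inv_mul_eq_iff_eq_mul, ← mul_assoc,
      ← Matrix.GeneralLinearGroup.scalar_commute] at e
    rw [e]
    simp only [mul_assoc]
  | hdiag a d =>
    exact ⟨_, weyl_mem, _, inv_mem weyl_mem, _, hdiag a d⟩
  | hanti a d =>
    refine ⟨1, one_mem _, (weyl v)⁻¹ * (weyl v)⁻¹, mul_mem (inv_mem weyl_mem) (inv_mem weyl_mem),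
      (a * d)⁻¹, ?_⟩
    rw [mul_inv_rev, hdiag, ← mul_assoc, ← Matrix.GeneralLinearGroup.scalar_commute]
    simp only [mul_assoc, one_mul, inv_mul_cancel_left, mul_inv_cancel_left]

/-! ### Cosets of the Iwahori subgroup and of the maximal compact subgroup -/

instance (v : HeightOneSpectrum (𝓞 F)) : Finite (𝓞 F ⧸ v.asIdeal) :=
  Ideal.finiteQuotientOfFreeOfNeBot _ v.ne_bot

instance (v : HeightOneSpectrum (𝓞 F)) : Fintype (𝓞 F ⧸ v.asIdeal) := Fintype.ofFinite _

theorem card_quotient_asIdeal (v : HeightOneSpectrum (𝓞 F)) :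
    Fintype.card (𝓞 F ⧸ v.asIdeal) = Ideal.absNorm v.asIdeal := by
  rw [← Nat.card_eq_fintype_card]
  rfl

/-- A representative in `F_v` of a residue class modulo `v`. -/
def residueRep (b : 𝓞 F ⧸ v.asIdeal) : v.adicCompletion F := algebraMap (𝓞 F) _ b.out

theorem valued_residueRep_le (b : 𝓞 F ⧸ v.asIdeal) : Valued.v (residueRep b) ≤ 1 := by
  exact HeightOneSpectrum.coe_mem_adicCompletionIntegers v b.out

theorem valued_lt_one_iff_le {ϖ x : v.adicCompletion F}
    (hϖ : Valued.v ϖ = WithZero.exp (-1 : ℤ)) : Valued.v x < 1 ↔ Valued.v (x / ϖ) ≤ 1 := by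
  rw [map_div₀, hϖ, div_le_one₀ (by simp), ← WithZero.lt_mul_exp_iff_le (by simp),
    ← WithZero.exp_add]
  simp

/-- The residue field of `O_v` is that of `𝓞 F` at `v`: an integral element of `F_v` is approximated
by an element of `F`, which can be chosen in `𝓞 F`. -/
theorem existsUnique_residueRep {x : v.adicCompletion F} (hx : Valued.v x ≤ 1) :
    ∃! b : 𝓞 F ⧸ v.asIdeal, Valued.v (x - residueRep b) < 1 := by
  have hval : ∀ y : F, Valued.v (algebraMap F (v.adicCompletion F) y) = v.valuation F y :=
    HeightOneSpectrum.valuedAdicCompletion_eq_valuation' v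
  have hlt : ∀ r : 𝓞 F, Valued.v (algebraMap (𝓞 F) (v.adicCompletion F) r) < 1 ↔
      r ∈ v.asIdeal := by
    intro r
    rw [← v.valuation_lt_one_iff_mem (K := F), ← hval]
    rfl
  have htri : ∀ {y z w : v.adicCompletion F}, Valued.v (y - z) < 1 → Valued.v (y - w) < 1 →
      Valued.v (z - w) < 1 := by
    intro y z w h h'
    have := Valuation.map_sub_lt _ h' h
    rwa [sub_sub_sub_cancel_left] at this
  obtain ⟨y, hy⟩ : ∃ y : F, Valued.v (x - algebraMap F (v.adicCompletion F) y) < 1 := by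
    obtain ⟨ϖ, hϖ⟩ := v.valuation_exists_uniformizer F
    rw [← hval] at hϖ
    have hopen : IsOpen {y : v.adicCompletion F | Valued.v (x - y) < 1} := by
      simp only [valued_lt_one_iff_le hϖ]
      exact (Valued.isOpen_integer (v.adicCompletion F)).preimage (by fun_prop)
    exact (HeightOneSpectrum.denseRange_algebraMap (K := F) v).exists_mem_open hopen ⟨x, by simp⟩
  have hy1 : v.valuation F y ≤ 1 := by
    have := Valuation.map_sub_le _ hx hy.le
    rwa [sub_sub_cancel, hval] at this
  obtain ⟨a, ha⟩ := v.exists_valuation_sub_lt_of_integer hy1 1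
  have hxa : Valued.v (x - algebraMap (𝓞 F) (v.adicCompletion F) a) < 1 := by
    have h1 : Valued.v (algebraMap F (v.adicCompletion F) y -
        algebraMap (𝓞 F) (v.adicCompletion F) a) < 1 := by
      rw [IsScalarTower.algebraMap_apply (𝓞 F) F (v.adicCompletion F),
        ← map_sub (algebraMap F (v.adicCompletion F)), hval, Valuation.map_sub_swap]
      exact ha
    have := Valuation.map_add_lt _ hy h1
    rwa [sub_add_sub_cancel] at this
  have hmk : ∀ b : 𝓞 F ⧸ v.asIdeal, Valued.v (x - residueRep b) < 1 ↔
      Ideal.Quotient.mk _ a = b := by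
    intro b
    have : Ideal.Quotient.mk _ a = b ↔ a - b.out ∈ v.asIdeal := by
      conv_lhs => rw [← Ideal.Quotient.mk_out b]
      exact Ideal.Quotient.eq
    rw [this, ← hlt, map_sub (algebraMap (𝓞 F) (v.adicCompletion F)), residueRep]
    refine ⟨fun h => htri hxa h, fun h => ?_⟩
    have := Valuation.map_add_lt _ hxa h
    rwa [sub_add_sub_cancel] at this
  exact ⟨_, (hmk _).2 rfl, fun b hb => ((hmk b).1 hb).symm⟩

variable (v) in
/-- Representatives of the cosets of the Iwahori subgroup in `GL₂(O_v)`, indexed by the points of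
the projective line over the residue field. -/
def iwahoriRep : Option (𝓞 F ⧸ v.asIdeal) → GLLocal v
  | none => 1
  | some b => upperUnip (residueRep b) * weyl v

theorem isLeftTransversal_iwahoriRep :
    IsLeftTransversal (iwahoriRep v) (localMaxCompact v) (iwahori v) := by
  have hmem : ∀ i, iwahoriRep v i ∈ localMaxCompact v := by
    rintro (_ | b)
    · exact one_mem _
    · exact mul_mem (iwahori_le (upperUnip_mem (valued_residueRep_le b))) weyl_mem
  refine ⟨hmem, fun k hk => ?_⟩
  have hiff : ∀ i, (iwahoriRep v i)⁻¹ * k ∈ iwahori v ↔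
      Valued.v (((iwahoriRep v i)⁻¹ * k) 1 0) < 1 := fun i =>
    and_iff_right (mul_mem (inv_mem (hmem i)) hk)
  have hsome : ∀ b, (iwahoriRep v (some b))⁻¹ * k ∈ iwahori v ↔
      Valued.v (k 0 0 - residueRep b * k 1 0) < 1 := by
    intro b
    rw [hiff, ← Valuation.map_neg]
    have : ((iwahoriRep v (some b))⁻¹ * k) 1 0 = -(k 0 0 - residueRep b * k 1 0) := by
      have h : iwahoriRep v (some b) * ((iwahoriRep v (some b))⁻¹ * k) = k :=
        mul_inv_cancel_left _ _
      generalize (iwahoriRep v (some b))⁻¹ * k = m at h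
      rw [← h]
      simp [iwahoriRep, Matrix.mul_apply]
    rw [this, neg_neg]
  have hnone : (iwahoriRep v none)⁻¹ * k ∈ iwahori v ↔ Valued.v (k 1 0) < 1 := by
    rw [hiff]
    simp [iwahoriRep]
  obtain ⟨hk, hdet⟩ := mem_localMaxCompact_iff.1 hk
  -- The first column of `k` modulo `v` is a point of the projective line, which is the point at
  -- infinity if the lower left entry vanishes modulo `v`.
  rcases lt_or_ge (Valued.v (k 1 0)) 1 with h | h
  · refine ⟨none, hnone.2 h, ?_⟩
    rintro (_ | b) hb
    · rfl
    · exfalso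
      rw [hsome] at hb
      have h' : Valued.v (residueRep b * k 1 0) < 1 := by
        rw [map_mul]
        exact mul_lt_one_of_nonneg_of_lt_one_right (valued_residueRep_le b) zero_le h
      have h00 : Valued.v (k 0 0) < 1 := by simpa using Valuation.map_add_lt _ hb h'
      refine hdet.not_lt ?_
      rw [Matrix.det_fin_two]
      refine Valuation.map_sub_lt _ ?_ ?_
      · rw [map_mul]
        exact mul_lt_one_of_nonneg_of_lt_one_left zero_le h00 (hk 1 1)
      · rw [map_mul]
        exact mul_lt_one_of_nonneg_of_lt_one_right (hk 0 1) zero_le h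
  · have h1 : Valued.v (k 1 0) = 1 := le_antisymm (hk 1 0) h
    have h0 : k 1 0 ≠ 0 := fun h0 => by simp [h0] at h1
    have hdiv : ∀ b, (iwahoriRep v (some b))⁻¹ * k ∈ iwahori v ↔
        Valued.v (k 0 0 / k 1 0 - residueRep b) < 1 := by
      intro b
      rw [hsome, div_sub' h0, map_div₀, h1, div_one, mul_comm]
    obtain ⟨b, hb, hb'⟩ := existsUnique_residueRep (x := k 0 0 / k 1 0) (by
      rw [map_div₀, h1, div_one]
      exact hk 0 0)
    refine ⟨some b, (hdiv b).2 hb, ?_⟩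
    rintro (_ | c) hc
    · exact absurd (hnone.1 hc) h.not_gt
    · exact congrArg some (hb' c ((hdiv c).1 hc))

/-- The stabilizer in `K_v` of the coset `diag(1, ϖ) K_v` is the Iwahori subgroup. -/
theorem inv_mul_mul_diagMatrix_mem_iff {ϖ : (v.adicCompletion F)ˣ} (hϖ : IsUniformizer ϖ)
    {k : GLLocal v} (hk : k ∈ localMaxCompact v) :
    (diagMatrix 1 ϖ)⁻¹ * k * diagMatrix 1 ϖ ∈ localMaxCompact v ↔ k ∈ iwahori v := by
  have hk' := mem_localMaxCompact_iff.1 hk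
  have hϖ1 : Valued.v (ϖ : v.adicCompletion F) ≤ 1 := by
    have : Valued.v (ϖ : v.adicCompletion F) = WithZero.exp (-1 : ℤ) := hϖ
    rw [this, ← WithZero.exp_zero, WithZero.exp_le_exp]
    simp
  have e : ((diagMatrix 1 ϖ)⁻¹ * k * diagMatrix 1 ϖ : GLLocal v) =
      (!![k 0 0, k 0 1 * ϖ; k 1 0 / ϖ, k 1 1] : Matrix (Fin 2) (Fin 2) (v.adicCompletion F)) := by
    have hinv : (diagMatrix 1 ϖ : GLLocal v)⁻¹ = diagMatrix 1 ϖ⁻¹ := by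
      refine inv_eq_of_mul_eq_one_right (localGL_ext ?_)
      rw [diagMatrix_mul_diagMatrix]
      simp [Matrix.one_fin_two]
    rw [hinv, Units.val_mul, Units.val_mul, coe_diagMatrix, coe_diagMatrix,
      Matrix.eta_fin_two (k : Matrix (Fin 2) (Fin 2) (v.adicCompletion F)), Matrix.mul_fin_two,
      Matrix.mul_fin_two]
    simp [div_eq_inv_mul, mul_right_comm _ (k 1 1)]
  have hdet : (k 0 0 * k 1 1 - k 0 1 * ϖ * (k 1 0 / ϖ)) =
      (k : Matrix (Fin 2) (Fin 2) (v.adicCompletion F)).det := by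
    rw [Matrix.det_fin_two]
    field_simp
  have h01 : Valued.v (k 0 1 * ϖ) ≤ 1 := by
    rw [map_mul]
    exact mul_le_one' (hk'.1 0 1) hϖ1
  rw [mem_localMaxCompact_iff, mem_iwahori_iff, e, valued_lt_one_iff_le hϖ, and_iff_right hk,
    Matrix.det_fin_two_of, hdet, and_iff_left hk'.2]
  refine ⟨fun h => h 1 0, fun h i j => ?_⟩
  fin_cases i <;> fin_cases j
  exacts [hk'.1 0 0, h01, h, hk'.1 1 1]

theorem IsUniformizer.valued_div {ϖ ϖ' : (v.adicCompletion F)ˣ} (hϖ : IsUniformizer ϖ)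
    (hϖ' : IsUniformizer ϖ') :
    Valued.v ((ϖ / ϖ' : (v.adicCompletion F)ˣ) : v.adicCompletion F) = 1 := by
  rw [Units.val_div_eq_div_val, map_div₀, hϖ, hϖ', div_self (by simp)]

/-- The double coset `K_v diag(ϖ, 1) K_v` may be described by a fixed uniformizer, and by
`diag(1, ϖ)` in place of `diag(ϖ, 1)`. -/
theorem mem_heckeSet_iff {ϖ : (v.adicCompletion F)ˣ} (hϖ : IsUniformizer ϖ) {h : GLLocal v} :
    h ∈ heckeSet v ↔ ∃ k ∈ localMaxCompact v, ∃ k' ∈ localMaxCompact v,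
      h = k * diagMatrix 1 ϖ * k' := by
  constructor
  · rintro ⟨ϖ', hϖ', k, hk, k', hk', rfl⟩
    refine ⟨k * (weyl v)⁻¹, mul_mem hk (inv_mem weyl_mem), diagMatrix 1 (ϖ' / ϖ) * weyl v * k',
      mul_mem (mul_mem (iwahori_le (diagMatrix_mem (by simp) (hϖ'.valued_div hϖ))) weyl_mem) hk',
      ?_⟩
    have := weyl_mul_diagMatrix ϖ' 1
    rw [← eq_inv_mul_iff_mul_eq] at this
    rw [this]
    have e : diagMatrix (v := v) 1 ϖ' = diagMatrix 1 ϖ * diagMatrix 1 (ϖ' / ϖ) := by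
      rw [diagMatrix_mul_diagMatrix]
      simp
    rw [e]
    simp only [mul_assoc]
  · rintro ⟨k, hk, k', hk', rfl⟩
    refine ⟨ϖ, hϖ, k * weyl v, mul_mem hk weyl_mem, (weyl v)⁻¹ * k',
      mul_mem (inv_mem weyl_mem) hk', ?_⟩
    rw [mul_assoc k (weyl v), weyl_mul_diagMatrix]
    simp [mul_assoc]

/-- Representatives of the cosets of `K_v` in `K_v diag(ϖ, 1) K_v`. -/
def heckeRep (ϖ : (v.adicCompletion F)ˣ) (i : Option (𝓞 F ⧸ v.asIdeal)) : GLLocal v :=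
  iwahoriRep v i * diagMatrix 1 ϖ

theorem isLeftTransversal_heckeRep {ϖ : (v.adicCompletion F)ˣ} (hϖ : IsUniformizer ϖ) :
    IsLeftTransversal (heckeRep ϖ) (heckeSet v) (localMaxCompact v) := by
  refine ⟨fun i => (mem_heckeSet_iff hϖ).2
    ⟨_, isLeftTransversal_iwahoriRep.1 i, 1, one_mem _, by rw [heckeRep, mul_one]⟩, fun h hh => ?_⟩
  obtain ⟨k, hk, k', hk', rfl⟩ := (mem_heckeSet_iff hϖ).1 hh
  refine (existsUnique_congr fun i => ?_).2 (isLeftTransversal_iwahoriRep.2 k hk)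
  rw [← inv_mul_mul_diagMatrix_mem_iff hϖ
    (mul_mem (inv_mem (isLeftTransversal_iwahoriRep.1 i)) hk)]
  have : (heckeRep ϖ i)⁻¹ * (k * diagMatrix 1 ϖ * k') =
      (diagMatrix 1 ϖ)⁻¹ * ((iwahoriRep v i)⁻¹ * k) * diagMatrix 1 ϖ * k' := by
    simp [heckeRep, mul_assoc]
  rw [this]
  exact Subgroup.mul_mem_cancel_right _ hk'

theorem mul_mem_heckeSet {k h : GLLocal v} (hk : k ∈ localMaxCompact v) (hh : h ∈ heckeSet v) :
    k * h ∈ heckeSet v := by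
  obtain ⟨ϖ, hϖ, k₁, hk₁, k₂, hk₂, rfl⟩ := hh
  exact ⟨ϖ, hϖ, k * k₁, mul_mem hk hk₁, k₂, hk₂, by simp only [mul_assoc]⟩

theorem heckeSet_mul_mem {k h : GLLocal v} (hk : k ∈ localMaxCompact v) (hh : h ∈ heckeSet v) :
    h * k ∈ heckeSet v := by
  obtain ⟨ϖ, hϖ, k₁, hk₁, k₂, hk₂, rfl⟩ := hh
  exact ⟨ϖ, hϖ, k₁, hk₁, k₂ * k, mul_mem hk₂ hk, by simp only [mul_assoc]⟩

theorem isOpen_localMaxCompact : IsOpen (localMaxCompact v : Set (GLLocal v)) := by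
  have e : (localMaxCompact v : Set (GLLocal v)) = ⋂ (i : Fin 2) (j : Fin 2),
      {g | g i j ∈ (Valued.v : Valuation (v.adicCompletion F) _).integer} ∩
        {g | g⁻¹ i j ∈ (Valued.v : Valuation (v.adicCompletion F) _).integer} := by
    ext g
    simp only [SetLike.mem_coe, Set.mem_iInter, Set.mem_inter_iff, Set.mem_ofPred_eq,
      Valuation.mem_integer_iff]
    refine ⟨fun h i j => ⟨(mem_localMaxCompact_iff.1 h).1 i j,
      (mem_localMaxCompact_iff.1 (inv_mem h)).1 i j⟩, fun h => ?_⟩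
    have hdet : ∀ g : GLLocal v, (∀ i j, Valued.v (g i j) ≤ 1) →
        Valued.v (g : Matrix (Fin 2) (Fin 2) (v.adicCompletion F)).det ≤ 1 := by
      intro g hg
      rw [Matrix.det_fin_two]
      refine Valuation.map_sub_le _ ?_ ?_ <;>
      · rw [map_mul]
        exact mul_le_one' (hg _ _) (hg _ _)
    refine mem_localMaxCompact_iff.2 ⟨fun i j => (h i j).1,
      le_antisymm (hdet g fun i j => (h i j).1) ?_⟩
    have h1 := hdet g⁻¹ fun i j => (h i j).2
    have h2 : Valued.v (g : Matrix (Fin 2) (Fin 2) (v.adicCompletion F)).det *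
        Valued.v (g⁻¹ : GLLocal v).1.det = 1 := by
      rw [← map_mul, ← Matrix.det_mul, ← Units.val_mul, mul_inv_cancel]
      simp
    rw [← h2]
    exact mul_le_of_le_one_right' h1
  rw [e]
  have hcont : ∀ i j, Continuous fun g : GLLocal v => g i j := fun i j =>
    (Units.continuous_val.matrix_elem i j)
  exact isOpen_iInter_of_finite fun i => isOpen_iInter_of_finite fun j =>
    ((Valued.isOpen_integer _).preimage (hcont i j)).inter
      ((Valued.isOpen_integer _).preimage ((hcont i j).comp continuous_inv))

/-- For the Haar measure which gives `K_v` measure `1`, the integral over `K_v diag(ϖ, 1) K_v` of a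
function which is constant on the left cosets of `K_v` is a sum over these cosets. -/
theorem setIntegral_heckeSet {ϖ : (v.adicCompletion F)ˣ} (hϖ : IsUniformizer ϖ)
    {E : Type*} [NormedAddCommGroup E] [NormedSpace ℝ E] [CompleteSpace E]
    (μ : Measure (GLLocal v)) [μ.IsHaarMeasure] (hμ : μ (localMaxCompact v : Set (GLLocal v)) = 1)
    (f : GLLocal v → E) (hf : ∀ g, ∀ k ∈ localMaxCompact v, f (g * k) = f g) :
    ∫ h in heckeSet v, f h ∂μ = ∑ i, f (heckeRep ϖ i) := by
  let C : Option (𝓞 F ⧸ v.asIdeal) → Set (GLLocal v) := fun i =>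
    (fun h => (heckeRep ϖ i)⁻¹ * h) ⁻¹' (localMaxCompact v : Set (GLLocal v))
  have hT := isLeftTransversal_heckeRep hϖ
  have hC : heckeSet v = ⋃ i, C i := by
    ext h
    simp only [Set.mem_iUnion]
    refine ⟨fun hh => (hT.2 h hh).exists, ?_⟩
    rintro ⟨i, hi⟩
    simpa using heckeSet_mul_mem hi (hT.1 i)
  have hmeas : ∀ i, MeasurableSet (C i) := fun i =>
    (isOpen_localMaxCompact.preimage (continuous_const.mul continuous_id)).measurableSet
  have hdisj : Pairwise (Function.onFun Disjoint C) := by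
    intro i j hij
    refine Set.disjoint_left.2 fun h hi hj => hij ?_
    have hh : h ∈ heckeSet v := hC ▸ Set.mem_iUnion.2 ⟨i, hi⟩
    exact (hT.2 h hh).unique hi hj
  have hconst : ∀ i, Set.EqOn f (fun _ => f (heckeRep ϖ i)) (C i) := fun i h hh => by
    simpa using hf (heckeRep ϖ i) _ hh
  have hvol : ∀ i, μ (C i) = 1 := fun i => by
    rw [measure_preimage_mul, hμ]
  rw [hC, integral_iUnion_fintype hmeas hdisj]
  · refine Finset.sum_congr rfl fun i _ => ?_
    rw [setIntegral_congr_fun (hmeas i) (hconst i), setIntegral_const, Measure.real, hvol]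
    simp
  · intro i
    refine (integrableOn_congr_fun (hconst i) (hmeas i)).2 (integrableOn_const (by simp [hvol]))

/-! ### The local Atkin–Lehner matrix -/

theorem diagMatrix_mul_weyl (ϖ : (v.adicCompletion F)ˣ) :
    diagMatrix 1 ϖ * weyl v = atkinLehnerMatrix ϖ := by
  apply localGL_ext
  simp

theorem atkinLehnerMatrix_mul_self (ϖ : (v.adicCompletion F)ˣ) :
    atkinLehnerMatrix ϖ * atkinLehnerMatrix ϖ = scalar (Fin 2) (-ϖ) := by
  apply localGL_ext
  rw [coe_scalar_fin_two]
  simp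

theorem weyl_mul_self : weyl v * weyl v = scalar (Fin 2) (-1) := by
  apply localGL_ext
  rw [coe_scalar_fin_two]
  simp

theorem diagMatrix_mul_atkinLehnerMatrix (ϖ ϖ' : (v.adicCompletion F)ˣ) :
    diagMatrix 1 (ϖ' / ϖ) * atkinLehnerMatrix ϖ = atkinLehnerMatrix ϖ' := by
  apply localGL_ext
  simp

theorem atkinLehnerMatrix_mul_diagMatrix (ϖ a d : (v.adicCompletion F)ˣ) :
    atkinLehnerMatrix ϖ * diagMatrix a d = diagMatrix d a * atkinLehnerMatrix ϖ := by
  apply localGL_ext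
  simp [mul_comm]

theorem diagMatrix_pow (a d : (v.adicCompletion F)ˣ) (n : ℕ) :
    diagMatrix a d ^ n = diagMatrix (a ^ n) (d ^ n) := by
  induction n with
  | zero =>
    apply localGL_ext
    simp [Matrix.one_fin_two]
  | succ n ih => rw [pow_succ, ih, diagMatrix_mul_diagMatrix, pow_succ, pow_succ]

theorem atkinLehnerMatrix_mul_inv_mul (ϖ : (v.adicCompletion F)ˣ) (g : GLLocal v) :
    ((atkinLehnerMatrix ϖ)⁻¹ * g * atkinLehnerMatrix ϖ : GLLocal v) =
      (!![g 1 1, -(g 1 0 / ϖ); -(g 0 1 * ϖ), g 0 0] :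
        Matrix (Fin 2) (Fin 2) (v.adicCompletion F)) := by
  have hinv : ((atkinLehnerMatrix ϖ)⁻¹ : GLLocal v) =
      (!![0, (ϖ : v.adicCompletion F)⁻¹; -1, 0] : Matrix (Fin 2) (Fin 2) (v.adicCompletion F)) := by
    rw [inv_apply_fin_two]
    simp
  rw [Units.val_mul, Units.val_mul, hinv, coe_atkinLehnerMatrix,
    Matrix.eta_fin_two (g : Matrix (Fin 2) (Fin 2) (v.adicCompletion F)), Matrix.mul_fin_two,
    Matrix.mul_fin_two]
  simp [div_eq_inv_mul, mul_right_comm _ (g 1 1)]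

/-- The Atkin–Lehner matrix normalizes the Iwahori subgroup. -/
theorem atkinLehnerMatrix_inv_mul_mul_mem {ϖ : (v.adicCompletion F)ˣ} (hϖ : IsUniformizer ϖ)
    {k : GLLocal v} (hk : k ∈ iwahori v) :
    (atkinLehnerMatrix ϖ)⁻¹ * k * atkinLehnerMatrix ϖ ∈ iwahori v := by
  have hk' := mem_localMaxCompact_iff.1 (iwahori_le hk)
  have h10 : Valued.v (k 1 0 / ϖ) ≤ 1 := (valued_lt_one_iff_le hϖ).1 hk.2
  have h01 : Valued.v (k 0 1 * ϖ) < 1 := by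
    rw [valued_lt_one_iff_le hϖ, mul_div_cancel_right₀ _ ϖ.ne_zero]
    exact hk'.1 0 1
  have hdet : ((atkinLehnerMatrix ϖ)⁻¹ * k * atkinLehnerMatrix ϖ).1.det = k.1.det := by
    simp [Matrix.det_mul, mul_right_comm]
  rw [mem_iwahori_iff, mem_localMaxCompact_iff, hdet, and_iff_left hk'.2,
    atkinLehnerMatrix_mul_inv_mul]
  refine ⟨fun i j => ?_, ?_⟩
  · fin_cases i <;> fin_cases j
    · exact hk'.1 1 1
    · exact (Valuation.map_neg _ _).trans_le h10
    · exact (Valuation.map_neg _ _).trans_le h01.le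
    · exact hk'.1 0 0
  · exact (Valuation.map_neg _ _).trans_lt h01

/-- The element `diag(1, ϖ) ^ n u` conjugates integral upper unipotent matrices into the Iwahori
subgroup. -/
theorem diagMatrix_pow_mul_upperUnip (ϖ : (v.adicCompletion F)ˣ) (n : ℕ) (t : v.adicCompletion F) :
    diagMatrix 1 ϖ ^ n * (atkinLehnerMatrix ϖ * upperUnip t) =
      lowerUnip (-((ϖ : v.adicCompletion F) ^ (n + 1) * t)) *
        (diagMatrix 1 ϖ ^ n * atkinLehnerMatrix ϖ) := by
  rw [diagMatrix_pow]
  apply localGL_ext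
  simp
  ring

/-- A form of the Bruhat decomposition with respect to the Iwahori subgroup: modulo the centre and
the Atkin–Lehner matrix, the double cosets are represented by the powers of `diag(1, ϖ)`. -/
theorem atkinLehner_induction {ϖ : (v.adicCompletion F)ˣ} (hϖ : IsUniformizer ϖ)
    {p : GLLocal v → Prop}
    (hl : ∀ k ∈ iwahori v, ∀ g, p (k * g) → p g) (hr : ∀ k ∈ iwahori v, ∀ g, p (g * k) → p g)
    (hz : ∀ (z : (v.adicCompletion F)ˣ) (g : GLLocal v), p g → p (scalar (Fin 2) z * g))
    (hul : ∀ g, p (atkinLehnerMatrix ϖ * g) → p g) (hur : ∀ g, p (g * atkinLehnerMatrix ϖ) → p g)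
    (hpow : ∀ n : ℕ, p (diagMatrix 1 ϖ ^ n)) (g : GLLocal v) : p g := by
  have hv : Valued.v (ϖ : v.adicCompletion F) = WithZero.exp (-1 : ℤ) := hϖ
  have hur' : ∀ g, p g → p (g * atkinLehnerMatrix ϖ) := fun g hg => hur _ <| by
    rw [mul_assoc, atkinLehnerMatrix_mul_self, ← Matrix.GeneralLinearGroup.scalar_commute]
    exact hz _ _ hg
  have hle : ∀ a d : (v.adicCompletion F)ˣ,
      Valued.v (d : v.adicCompletion F) ≤ Valued.v (a : v.adicCompletion F) →
        p (diagMatrix a d) := by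
    intro a d h
    obtain ⟨n, hn⟩ : ∃ n : ℕ, Valued.v ((d / a : (v.adicCompletion F)ˣ) : v.adicCompletion F) =
        WithZero.exp (-(n : ℤ)) := by
      have h0 : Valued.v ((d / a : (v.adicCompletion F)ˣ) : v.adicCompletion F) ≠ 0 := by simp
      have h1 : Valued.v ((d / a : (v.adicCompletion F)ˣ) : v.adicCompletion F) ≤ 1 := by
        rw [Units.val_div_eq_div_val, map_div₀]
        exact div_le_one_of_le₀ h zero_le
      rw [← WithZero.exp_zero, ← WithZero.log_le_iff_le_exp h0] at h1
      refine ⟨(-WithZero.log (Valued.v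
        ((d / a : (v.adicCompletion F)ˣ) : v.adicCompletion F))).toNat, ?_⟩
      rw [Int.toNat_of_nonneg (by simpa using h1), neg_neg, WithZero.exp_log h0]
    have hunit : Valued.v ((ϖ ^ n / (d / a) : (v.adicCompletion F)ˣ) : v.adicCompletion F) = 1 := by
      rw [Units.val_div_eq_div_val, map_div₀, hn, Units.val_pow_eq_pow_val, map_pow, hv,
        ← WithZero.exp_nsmul]
      simp
    refine hr _ (diagMatrix_mem (a := 1) (by simp) hunit) _ ?_
    have : diagMatrix a d * diagMatrix 1 (ϖ ^ n / (d / a)) =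
        scalar (Fin 2) a * diagMatrix (v := v) 1 ϖ ^ n := by
      rw [diagMatrix_mul_diagMatrix, diagMatrix_pow]
      apply localGL_ext
      rw [Units.val_mul, coe_scalar_fin_two]
      simp
      field_simp
    rw [this]
    exact hz _ _ (hpow n)
  have hD : ∀ a d : (v.adicCompletion F)ˣ, p (diagMatrix a d) := by
    intro a d
    rcases le_total (Valued.v (d : v.adicCompletion F)) (Valued.v (a : v.adicCompletion F))
      with h | h
    · exact hle a d h
    · refine hul _ ?_
      rw [atkinLehnerMatrix_mul_diagMatrix]
      exact hur' _ (hle d a h)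
  refine bruhat_induction hl hr hD (fun a d => hur _ ?_) g
  rw [← diagMatrix_mul_weyl, mul_assoc, ← mul_assoc (weyl v), weyl_mul_diagMatrix,
    mul_assoc (diagMatrix ϖ 1), weyl_mul_self, ← mul_assoc,
    ← Matrix.GeneralLinearGroup.scalar_commute, diagMatrix_mul_diagMatrix]
  exact hz _ _ (hD _ _)

end Local

section Adelic

open Matrix.GeneralLinearGroup (scalar)

variable {F : Type*} [Field F] [NumberField F] {v w : HeightOneSpectrum (𝓞 F)}

/-! ### The local groups inside the adelic group -/

theorem finiteComponent_adeleSingle_self (x : v.adicCompletion F) :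
    finiteComponent v (adeleSingle v x) = x := by
  classical
  exact Pi.single_eq_same (M := fun v : HeightOneSpectrum (𝓞 F) => v.adicCompletion F) v x

theorem finiteComponent_adeleSingle_of_ne (h : w ≠ v) (x : v.adicCompletion F) :
    finiteComponent w (adeleSingle v x) = 0 := by
  classical
  exact Pi.single_eq_of_ne (M := fun v : HeightOneSpectrum (𝓞 F) => v.adicCompletion F) h x

theorem infiniteComponent_adeleSingle (u : InfinitePlace F) (x : v.adicCompletion F) :
    infiniteComponent u (adeleSingle v x) = 0 := rfl

theorem adele_ext {x y : Adele F} (hi : ∀ u, infiniteComponent u x = infiniteComponent u y)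
    (hf : ∀ v, finiteComponent v x = finiteComponent v y) : x = y :=
  Prod.ext (funext hi) (FiniteAdeleRing.ext F hf)

theorem adeleSingle_mul (x : v.adicCompletion F) (y : Adele F) :
    adeleSingle v x * y = adeleSingle v (x * finiteComponent v y) := by
  refine adele_ext (fun u => ?_) fun w => ?_
  · simp [infiniteComponent_adeleSingle]
  · by_cases h : w = v
    · subst h
      simp [finiteComponent_adeleSingle_self]
    · simp [finiteComponent_adeleSingle_of_ne h]

theorem coe_localInclusion (g : GLLocal v) :
    (localInclusion v g : Matrix (Fin 2) (Fin 2) (Adele F)) =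
      1 + ((g : Matrix (Fin 2) (Fin 2) (v.adicCompletion F)) - 1).map (adeleSingle v) := rfl

theorem map_finiteComponent_localInclusion_self (g : GLLocal v) :
    Matrix.GeneralLinearGroup.map (finiteComponent v) (localInclusion v g) = g := by
  ext i j
  have : finiteComponent v ((1 : Matrix (Fin 2) (Fin 2) (Adele F)) i j) =
      (1 : Matrix (Fin 2) (Fin 2) (v.adicCompletion F)) i j := by
    simp [Matrix.one_apply, apply_ite (finiteComponent v)]
  simp [coe_localInclusion, finiteComponent_adeleSingle_self, this]

theorem map_finiteComponent_localInclusion_of_ne (h : w ≠ v) (g : GLLocal v) :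
    Matrix.GeneralLinearGroup.map (finiteComponent w) (localInclusion v g) = 1 := by
  ext i j
  simp [coe_localInclusion, finiteComponent_adeleSingle_of_ne h, Matrix.one_apply,
    apply_ite (finiteComponent w)]

theorem map_infiniteComponent_localInclusion (u : InfinitePlace F) (g : GLLocal v) :
    Matrix.GeneralLinearGroup.map (infiniteComponent u) (localInclusion v g) = 1 := by
  ext i j
  simp [coe_localInclusion, infiniteComponent_adeleSingle, Matrix.one_apply,
    apply_ite (infiniteComponent u)]

theorem localInclusion_commute {b : GLAdele F}
    (hb : Matrix.GeneralLinearGroup.map (finiteComponent v) b = 1) (g : GLLocal v) :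
    Commute (localInclusion v g) b := by
  have hb' : ∀ i j, finiteComponent v (b i j) =
      (1 : Matrix (Fin 2) (Fin 2) (v.adicCompletion F)) i j := fun i j => by
    rw [← Matrix.GeneralLinearGroup.map_apply, hb]
    rfl
  have h1 : ((g : Matrix (Fin 2) (Fin 2) (v.adicCompletion F)) - 1).map (adeleSingle v) * b =
      ((g : Matrix (Fin 2) (Fin 2) (v.adicCompletion F)) - 1).map (adeleSingle v) := by
    generalize (g : Matrix (Fin 2) (Fin 2) (v.adicCompletion F)) - 1 = m
    ext1 i j
    simp only [Matrix.mul_apply, Matrix.map_apply, adeleSingle_mul, hb', ← map_sum]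
    rw [← Matrix.mul_apply, mul_one]
  have h2 : (b : Matrix (Fin 2) (Fin 2) (Adele F)) *
      ((g : Matrix (Fin 2) (Fin 2) (v.adicCompletion F)) - 1).map (adeleSingle v) =
      ((g : Matrix (Fin 2) (Fin 2) (v.adicCompletion F)) - 1).map (adeleSingle v) := by
    generalize (g : Matrix (Fin 2) (Fin 2) (v.adicCompletion F)) - 1 = m
    ext1 i j
    simp only [Matrix.mul_apply, Matrix.map_apply, mul_comm (b i _), adeleSingle_mul, hb',
      ← map_sum, mul_comm (m _ _)]
    rw [← Matrix.mul_apply, one_mul]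
  refine Units.ext ?_
  rw [Units.val_mul, Units.val_mul, coe_localInclusion, add_mul, mul_add, h1, h2, one_mul, mul_one]

theorem localInclusion_commute_localInclusion (h : w ≠ v) (g : GLLocal v) (g' : GLLocal w) :
    Commute (localInclusion v g) (localInclusion w g') :=
  localInclusion_commute (map_finiteComponent_localInclusion_of_ne h.symm g') g

/-- Every adelic matrix is the product of its component at `v` and a matrix with trivial component
at `v`. -/
theorem exists_eq_localInclusion_mul (v : HeightOneSpectrum (𝓞 F)) (g : GLAdele F) :
    ∃ b : GLAdele F, Matrix.GeneralLinearGroup.map (finiteComponent v) b = 1 ∧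
      g = localInclusion v (Matrix.GeneralLinearGroup.map (finiteComponent v) g) * b := by
  refine ⟨(localInclusion v (Matrix.GeneralLinearGroup.map (finiteComponent v) g))⁻¹ * g, ?_,
    (mul_inv_cancel_left _ _).symm⟩
  rw [map_mul, map_inv, map_finiteComponent_localInclusion_self, inv_mul_cancel]

theorem exists_localInclusion_scalar (z : (v.adicCompletion F)ˣ) :
    ∃ z' : (Adele F)ˣ, localInclusion v (scalar (Fin 2) z) = scalar (Fin 2) z' := by
  have hinv : ∀ a b : v.adicCompletion F, a * b = 1 →
      (1 + adeleSingle v (a - 1)) * (1 + adeleSingle v (b - 1)) = 1 := by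
    intro a b h
    rw [add_mul, mul_add, mul_add, ← map_mul]
    have : (a - 1) * (b - 1) = -((a - 1) + (b - 1)) := by linear_combination h
    rw [this, map_neg, map_add]
    ring
  refine ⟨⟨1 + adeleSingle v (z - 1), 1 + adeleSingle v ((z⁻¹ : (v.adicCompletion F)ˣ) - 1),
    hinv _ _ (by simp), hinv _ _ (by simp)⟩, ?_⟩
  refine Units.ext ?_
  rw [coe_localInclusion, coe_scalar_fin_two]
  ext1 i j
  fin_cases i <;> fin_cases j <;> simp

/-! ### Local components of the compact subgroups -/

theorem valued_algebraMap_lt_one_iff (r : 𝓞 F) :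
    Valued.v (algebraMap (𝓞 F) (v.adicCompletionIntegers F) r : v.adicCompletion F) < 1 ↔
      r ∈ v.asIdeal := by
  rw [← v.valuation_lt_one_iff_mem (K := F)]
  exact iff_of_eq (congrArg (· < 1) (HeightOneSpectrum.valuedAdicCompletion_eq_valuation v r))

theorem mem_map_asIdeal_iff (x : v.adicCompletionIntegers F) :
    x ∈ v.asIdeal.map (algebraMap (𝓞 F) (v.adicCompletionIntegers F)) ↔
      Valued.v (x : v.adicCompletion F) < 1 := by
  constructor
  · intro hx
    have hle : v.asIdeal.map (algebraMap (𝓞 F) (v.adicCompletionIntegers F)) ≤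
        IsLocalRing.maximalIdeal (v.adicCompletionIntegers F) := by
      rw [Ideal.map_le_iff_le_comap]
      intro r hr
      rw [Ideal.mem_comap, IsLocalRing.mem_maximalIdeal, mem_nonunits_iff,
        HeightOneSpectrum.adicCompletionIntegers.isUnit_iff_valued_eq_one]
      exact ((valued_algebraMap_lt_one_iff r).2 hr).ne
    have := hle hx
    rw [IsLocalRing.mem_maximalIdeal, mem_nonunits_iff,
      HeightOneSpectrum.adicCompletionIntegers.isUnit_iff_valued_eq_one] at this
    exact lt_of_le_of_ne x.2 this
  · intro hx
    obtain ⟨r, hr⟩ := v.intValuation_exists_uniformizer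
    have hr' : Valued.v (algebraMap (𝓞 F) (v.adicCompletionIntegers F) r : v.adicCompletion F) =
        WithZero.exp (-1 : ℤ) := by
      rw [← hr, ← v.valuation_of_algebraMap (K := F)]
      exact HeightOneSpectrum.valuedAdicCompletion_eq_valuation v r
    have hr0 : (algebraMap (𝓞 F) (v.adicCompletionIntegers F) r : v.adicCompletion F) ≠ 0 :=
      fun h => by
        rw [h, map_zero] at hr'
        exact WithZero.exp_ne_zero hr'.symm
    have hmem : r ∈ v.asIdeal := by
      rw [← valued_algebraMap_lt_one_iff, hr', ← WithZero.exp_zero, WithZero.exp_lt_exp]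
      simp
    have : x = algebraMap (𝓞 F) (v.adicCompletionIntegers F) r *
        ⟨x / algebraMap (𝓞 F) (v.adicCompletionIntegers F) r,
          (valued_lt_one_iff_le hr').1 hx⟩ := by
      refine Subtype.ext ?_
      exact (mul_div_cancel₀ _ hr0).symm
    rw [this]
    exact Ideal.mul_mem_right _ _ (Ideal.mem_map_of_mem _ hmem)

theorem map_asIdeal_of_ne (h : w ≠ v) :
    v.asIdeal.map (algebraMap (𝓞 F) (w.adicCompletionIntegers F)) = ⊤ := by
  have hle : ¬v.asIdeal ≤ w.asIdeal := fun hle =>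
    h (HeightOneSpectrum.ext (v.isMaximal.eq_of_le w.isPrime.ne_top hle).symm)
  obtain ⟨r, hr, hr'⟩ := SetLike.not_le_iff_exists.1 hle
  refine Ideal.eq_top_of_isUnit_mem _ (Ideal.mem_map_of_mem _ hr) ?_
  rw [HeightOneSpectrum.adicCompletionIntegers.isUnit_iff_valued_eq_one]
  exact le_antisymm (Subtype.prop (algebraMap (𝓞 F) (w.adicCompletionIntegers F) r))
    (not_lt.1 ((valued_algebraMap_lt_one_iff r).not.2 hr'))

theorem localKZero_of_map_eq_top {𝔞 : Ideal (𝓞 F)}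
    (h : 𝔞.map (algebraMap (𝓞 F) (v.adicCompletionIntegers F)) = ⊤) :
    localKZero v 𝔞 = localMaxCompact v := by
  ext g
  refine ⟨fun ⟨k, hk, _⟩ => ⟨k, hk⟩, fun ⟨k, hk⟩ => ⟨k, hk, by simp [h]⟩⟩

theorem localKZero_top : localKZero v ⊤ = localMaxCompact v :=
  localKZero_of_map_eq_top (Ideal.map_top _)

theorem localKZero_of_ne (h : w ≠ v) : localKZero w v.asIdeal = localMaxCompact w :=
  localKZero_of_map_eq_top (map_asIdeal_of_ne h)

theorem localKZero_self : localKZero v v.asIdeal = iwahori v := by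
  ext g
  constructor
  · rintro ⟨k, rfl, hk⟩
    exact ⟨⟨k, rfl⟩, (mem_map_asIdeal_iff _).1 hk⟩
  · rintro ⟨⟨k, rfl⟩, hk⟩
    exact ⟨k, rfl, (mem_map_asIdeal_iff _).2 hk⟩

theorem one_mem_localKZero (𝔞 : Ideal (𝓞 F)) : 1 ∈ localKZero v 𝔞 :=
  ⟨1, map_one _, by simp⟩

theorem localInclusion_mem_KZero {𝔞 : Ideal (𝓞 F)} {k : GLLocal v} (hk : k ∈ localKZero v 𝔞) :
    localInclusion v k ∈ KZero 𝔞 := by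
  refine ⟨fun u => map_infiniteComponent_localInclusion u k, fun w => ?_⟩
  by_cases h : w = v
  · subst h
    rwa [map_finiteComponent_localInclusion_self]
  · rw [map_finiteComponent_localInclusion_of_ne h]
    exact one_mem_localKZero 𝔞

theorem localKZero_subset (𝔞 : Ideal (𝓞 F)) : localKZero v 𝔞 ⊆ localMaxCompact v :=
  fun _ ⟨k, hk, _⟩ => ⟨k, hk⟩

/-- An element of `K₀(𝔞)` is the product of its component at `v` and an element of `K₀(𝔞)` with
trivial component at `v`; the latter is in `K₀(v)`, whatever `𝔞` is away from `v`. -/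
theorem exists_eq_localInclusion_mul_of_mem_KZero (v : HeightOneSpectrum (𝓞 F)) {𝔞 : Ideal (𝓞 F)}
    {g : GLAdele F} (hg : g ∈ KZero 𝔞) :
    ∃ k ∈ localKZero v 𝔞, ∃ b ∈ KZero v.asIdeal,
      Matrix.GeneralLinearGroup.map (finiteComponent v) b = 1 ∧ g = localInclusion v k * b := by
  obtain ⟨b, hb, e⟩ := exists_eq_localInclusion_mul v g
  have hk := hg.2 v
  generalize Matrix.GeneralLinearGroup.map (finiteComponent v) g = k at e hk
  refine ⟨k, hk, b, ⟨fun u => ?_, fun w => ?_⟩, hb, e⟩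
  · have := hg.1 u
    rwa [e, map_mul, map_infiniteComponent_localInclusion, one_mul] at this
  · by_cases hw : w = v
    · subst hw
      rw [hb]
      exact one_mem_localKZero _
    · have := hg.2 w
      rw [e, map_mul, map_finiteComponent_localInclusion_of_ne hw, one_mul] at this
      rw [localKZero_of_ne hw]
      exact localKZero_subset 𝔞 this

end Adelic

section Representations

open Matrix.GeneralLinearGroup (scalar)

variable {F : Type*} [Field F] [NumberField F] {v : HeightOneSpectrum (𝓞 F)}

theorem exists_isUniformizer (v : HeightOneSpectrum (𝓞 F)) :
    ∃ ϖ : (v.adicCompletion F)ˣ, IsUniformizer ϖ := by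
  obtain ⟨ϖ, hϖ⟩ := v.valuation_exists_uniformizer F
  have h : Valued.v (algebraMap F (v.adicCompletion F) ϖ) = WithZero.exp (-1 : ℤ) :=
    (HeightOneSpectrum.valuedAdicCompletion_eq_valuation' v ϖ).trans hϖ
  refine ⟨Units.mk0 (algebraMap F (v.adicCompletion F) ϖ) fun h0 => ?_, h⟩
  rw [h0, map_zero] at h
  exact WithZero.exp_ne_zero h.symm

namespace UnitaryRep

variable {H : Type*} [NormedAddCommGroup H] [InnerProductSpace ℂ H] (π : UnitaryRep F H)

/-! ### Fixed vectors -/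

theorem isClosed_fixedBy (S : Set (GLAdele F)) : IsClosed (π.fixedBy S : Set H) := by
  have : (π.fixedBy S : Set H) = ⋂ g ∈ S, {x | π.act g x = x} := by
    ext x
    simp [fixedBy]
  rw [this]
  exact isClosed_biInter fun g _ => isClosed_eq (π.act g).continuous continuous_id

theorem act_mul_apply (g h : GLAdele F) (x : H) : π.act (g * h) x = π.act g (π.act h x) := by
  rw [map_mul]
  rfl

/-- The operator by which an element of the local group `GL₂(F_v)` acts. -/
def localAct (v : HeightOneSpectrum (𝓞 F)) : GLLocal v →* (H ≃ₗᵢ[ℂ] H) :=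
  π.act.comp (localInclusion v)

theorem localAct_apply (g : GLLocal v) (x : H) : π.localAct v g x = π.act (localInclusion v g) x :=
  rfl

theorem localAct_mul_apply (g h : GLLocal v) (x : H) :
    π.localAct v (g * h) x = π.localAct v g (π.localAct v h x) := by
  rw [localAct_apply, map_mul, act_mul_apply]
  rfl

theorem inner_localAct_left (g : GLLocal v) (x y : H) :
    inner ℂ (π.localAct v g x) y = inner ℂ x (π.localAct v g⁻¹ y) := by
  rw [← (π.localAct v g).inner_map_map x, ← localAct_mul_apply, mul_inv_cancel, map_one]
  rfl

theorem localAct_scalar (z : (v.adicCompletion F)ˣ) : π.localAct v (scalar (Fin 2) z) = 1 := by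
  obtain ⟨z', hz'⟩ := exists_localInclusion_scalar z
  rw [localAct, MonoidHom.comp_apply, hz', π.act_center]

theorem localAct_scalar_mul (z : (v.adicCompletion F)ˣ) (g : GLLocal v) :
    π.localAct v (scalar (Fin 2) z * g) = π.localAct v g := by
  rw [map_mul, localAct_scalar, one_mul]

theorem act_localAct_comm {b : GLAdele F}
    (hb : Matrix.GeneralLinearGroup.map (finiteComponent v) b = 1) (g : GLLocal v) (x : H) :
    π.act b (π.localAct v g x) = π.localAct v g (π.act b x) := by
  have := congrArg (π.act · x) (localInclusion_commute hb g).eq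
  simp only [map_mul] at this
  exact this.symm

/-- The vectors fixed by a subgroup of the local group at `v`. -/
def localFixed (L : Subgroup (GLLocal v)) : Submodule ℂ H := π.fixedBy (localInclusion v '' L)

variable {π} in
theorem mem_localFixed {L : Subgroup (GLLocal v)} {x : H} :
    x ∈ π.localFixed L ↔ ∀ k ∈ L, π.localAct v k x = x := Set.forall_mem_image

theorem act_mem_localFixed {b : GLAdele F}
    (hb : Matrix.GeneralLinearGroup.map (finiteComponent v) b = 1) {L : Subgroup (GLLocal v)}
    {x : H}
    (hx : x ∈ π.localFixed L) : π.act b x ∈ π.localFixed L := by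
  rw [mem_localFixed] at hx ⊢
  intro k hk
  rw [← act_localAct_comm π hb, hx k hk]

/-- A matrix coefficient of the adelic group at `a b`, with `a` in the local group at `v` and `b`
trivial at `v`, is a matrix coefficient of the local group at `a`, for a translate of `y`. If `y` is
fixed by a subgroup of the local group, then so is the translate, by `act_mem_localFixed`. -/
theorem inner_act_localInclusion_mul {b : GLAdele F}
    (hb : Matrix.GeneralLinearGroup.map (finiteComponent v) b = 1) (a : GLLocal v) (x y : H) :
    inner ℂ y (π.act (localInclusion v a * b) x) =
      inner ℂ (π.act b⁻¹ y) (π.localAct v a x) := by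
  rw [(localInclusion_commute hb a).eq, ← (π.act b).inner_map_map (π.act b⁻¹ y), map_mul, map_inv]
  simp [localAct_apply]

/-- A sum of translates of `x` over left cosets of a group fixing `x` is fixed by the elements
which permute the cosets. -/
theorem localAct_sum {ι : Type*} [Fintype ι] {r : ι → GLLocal v} {S : Set (GLLocal v)}
    {L : Subgroup (GLLocal v)} (hr : IsLeftTransversal r S L) {k : GLLocal v}
    (hk : ∀ s ∈ S, k * s ∈ S) {x : H} (hx : x ∈ π.localFixed L) :
    π.localAct v k (∑ i, π.localAct v (r i) x) = ∑ i, π.localAct v (r i) x := by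
  rw [map_sum]
  simp only [← localAct_mul_apply]
  refine hr.sum_mul_left hk (fun g => π.localAct v g x) fun g l hl => ?_
  rw [localAct_mul_apply, mem_localFixed.1 hx l hl]

/-! ### The Hecke operator -/

section Hecke

/-- The commutativity of the spherical Hecke algebra, for the matrix coefficients of spherical
vectors: by `exists_inv_eq` such a function `f` satisfies `f g⁻¹ = f g`. -/
theorem sum_heckeRep_comm {ϖ : (v.adicCompletion F)ˣ} (hϖ : IsUniformizer ϖ)
    (f : GLLocal v → ℂ) (hl : ∀ k ∈ localMaxCompact v, ∀ g, f (k * g) = f g)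
    (hr : ∀ g, ∀ k ∈ localMaxCompact v, f (g * k) = f g)
    (hz : ∀ (z : (v.adicCompletion F)ˣ) (g : GLLocal v), f (scalar (Fin 2) z * g) = f g)
    (a : GLLocal v) :
    ∑ i, f (a * heckeRep ϖ i) = ∑ i, f ((heckeRep ϖ i)⁻¹ * a) := by
  have hinv : ∀ g, f g⁻¹ = f g := fun g => by
    obtain ⟨k, hk, k', hk', z, e⟩ := exists_inv_eq g
    rw [e, hz, hr _ _ hk', hl _ hk]
  obtain ⟨k, hk, k', hk', z, e⟩ := exists_inv_eq a
  have h1 : ∀ i, f ((heckeRep ϖ i)⁻¹ * a) = f (a * (k' * heckeRep ϖ i)) := fun i => by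
    rw [← hinv, mul_inv_rev, inv_inv, e, mul_assoc, hz, mul_assoc, mul_assoc, hl _ hk]
  simp only [h1]
  refine ((isLeftTransversal_heckeRep hϖ).sum_mul_left (fun s hs => mul_mem_heckeSet hk' hs)
    (fun g => f (a * g)) fun g l hl => ?_).symm
  simp only [← mul_assoc, hr _ l hl]

variable [CompleteSpace H]

/-- In an irreducible representation, the sum over the cosets in `K_v diag(ϖ, 1) K_v` acts on the
vectors fixed by `K_v` as a real scalar. -/
theorem exists_sum_heckeRep_eq (hπ : π.IsIrreducible) {ϖ : (v.adicCompletion F)ˣ}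
    (hϖ : IsUniformizer ϖ) :
    ∃ c : ℝ, ∀ x ∈ π.localFixed (localMaxCompact v),
      ∑ i, π.localAct v (heckeRep ϖ i) x = c • x := by
  let E := π.localFixed (localMaxCompact v)
  let T : E →ₗ[ℂ] E := LinearMap.restrict
    (∑ i, (π.localAct v (heckeRep ϖ i)).toLinearEquiv.toLinearMap) (p := E) (q := E) (by
      intro x hx
      refine mem_localFixed.2 fun k hk => ?_
      simpa using π.localAct_sum (isLeftTransversal_heckeRep hϖ)
        (fun s hs => mul_mem_heckeSet hk hs) hx)
  have hT : ∀ x : E, (T x : H) = ∑ i, π.localAct v (heckeRep ϖ i) x := fun x => by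
    simp [T, LinearMap.restrict_apply]
  obtain ⟨c, hc⟩ := exists_eq_smul_of_compression_commute π.act hπ.2 E (π.isClosed_fixedBy _) T (by
    intro g x y
    obtain ⟨b, hb, e⟩ := exists_eq_localInclusion_mul v g
    generalize Matrix.GeneralLinearGroup.map (finiteComponent v) g = a at e
    subst e
    have hb' : Matrix.GeneralLinearGroup.map (finiteComponent v) b⁻¹ = 1 := by
      rw [map_inv, hb, inv_one]
    rw [inner_act_localInclusion_mul π hb, inner_act_localInclusion_mul π hb]
    have hy := π.act_mem_localFixed hb' y.2
    have hTy : π.act b⁻¹ (T y) = ∑ i, π.localAct v (heckeRep ϖ i) (π.act b⁻¹ y) := by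
      simp only [hT, map_sum, act_localAct_comm π hb']
    rw [hT, hTy, map_sum, inner_sum, sum_inner]
    simp only [inner_localAct_left, ← localAct_mul_apply]
    refine sum_heckeRep_comm hϖ (fun g => inner ℂ (π.act b⁻¹ y) (π.localAct v g x))
      (fun k hk g => ?_) (fun g k hk => ?_) (fun z g => ?_) a
    · rw [localAct_mul_apply, ← inv_inv k, ← inner_localAct_left,
        mem_localFixed.1 hy _ (inv_mem hk)]
    · rw [localAct_mul_apply, mem_localFixed.1 x.2 _ hk]
    · rw [localAct_scalar_mul])
  refine ⟨c, fun x hx => ?_⟩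
  rw [← hT ⟨x, hx⟩, hc]
  rfl

/-- On spherical vectors the Hecke operator is a sum of translates. -/
theorem hecke_eq_sum {ϖ : (v.adicCompletion F)ˣ} (hϖ : IsUniformizer ϖ)
    (μ : Measure (GLLocal v)) [μ.IsHaarMeasure] (hμ : μ (localMaxCompact v : Set (GLLocal v)) = 1)
    {x : H} (hx : x ∈ π.localFixed (localMaxCompact v)) :
    π.hecke v μ x = (1 / √(Ideal.absNorm v.asIdeal : ℝ)) •
      ∑ i, π.localAct v (heckeRep ϖ i) x := by
  rw [hecke, setIntegral_heckeSet hϖ μ hμ (fun h => π.act (localInclusion v h) x)]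
  · rfl
  · intro g k hk
    have := mem_localFixed.1 hx k hk
    rw [localAct_apply] at this
    rw [map_mul, act_mul_apply, this]

end Hecke

/-! ### The Atkin–Lehner operator -/

section AtkinLehner

theorem fixedBy_KZero_le_localFixed : π.fixedBy (KZero v.asIdeal) ≤ π.localFixed (iwahori v) := by
  intro x hx
  refine mem_localFixed.2 fun k hk => hx _ (localInclusion_mem_KZero ?_)
  rwa [localKZero_self]

theorem fixedBy_KZero_le_localFixed_of_ne {w : HeightOneSpectrum (𝓞 F)} (h : w ≠ v) :
    π.fixedBy (KZero v.asIdeal) ≤ π.localFixed (localMaxCompact w) := by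
  intro x hx
  refine mem_localFixed.2 fun k hk => hx _ (localInclusion_mem_KZero ?_)
  rwa [localKZero_of_ne h]

/-- If there are no vectors of level one, then the trace to level one of a vector of level `v`
vanishes. -/
theorem sum_iwahoriRep_eq_zero (h : π.fixedBy (KZero (⊤ : Ideal (𝓞 F))) = ⊥) {x : H}
    (hx : x ∈ π.fixedBy (KZero v.asIdeal)) : ∑ i, π.localAct v (iwahoriRep v i) x = 0 := by
  rw [← Submodule.mem_bot ℂ, ← h]
  intro g hg
  obtain ⟨k, hk, b, hb', hb, rfl⟩ := exists_eq_localInclusion_mul_of_mem_KZero v hg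
  rw [localKZero_top] at hk
  rw [act_mul_apply, map_sum]
  simp only [act_localAct_comm π hb, hx b hb']
  exact π.localAct_sum isLeftTransversal_iwahoriRep (fun s hs => mul_mem hk hs)
    (π.fixedBy_KZero_le_localFixed hx)

theorem atkinLehner_mem_localFixed {ϖ : (v.adicCompletion F)ˣ} (hϖ : IsUniformizer ϖ) {x : H}
    (hx : x ∈ π.localFixed (iwahori v)) :
    π.localAct v (atkinLehnerMatrix ϖ) x ∈ π.localFixed (iwahori v) := by
  refine mem_localFixed.2 fun k hk => ?_
  have := mem_localFixed.1 hx _ (atkinLehnerMatrix_inv_mul_mul_mem hϖ hk)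
  conv_rhs => rw [← this]
  simp only [← localAct_mul_apply]
  simp only [mul_assoc, mul_inv_cancel_left]

theorem atkinLehner_mem {ϖ : (v.adicCompletion F)ˣ} (hϖ : IsUniformizer ϖ) {x : H}
    (hx : x ∈ π.fixedBy (KZero v.asIdeal)) :
    π.localAct v (atkinLehnerMatrix ϖ) x ∈ π.fixedBy (KZero v.asIdeal) := by
  intro g hg
  obtain ⟨k, hk, b, hb', hb, rfl⟩ := exists_eq_localInclusion_mul_of_mem_KZero v hg
  rw [localKZero_self] at hk
  rw [act_mul_apply, act_localAct_comm π hb, hx b hb']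
  exact mem_localFixed.1 (π.atkinLehner_mem_localFixed hϖ (π.fixedBy_KZero_le_localFixed hx)) k hk

theorem atkinLehner_atkinLehner (ϖ : (v.adicCompletion F)ˣ) (x : H) :
    π.localAct v (atkinLehnerMatrix ϖ) (π.localAct v (atkinLehnerMatrix ϖ) x) = x := by
  rw [← localAct_mul_apply, atkinLehnerMatrix_mul_self, localAct_scalar]
  rfl

theorem inner_atkinLehner_left (ϖ : (v.adicCompletion F)ˣ) (x y : H) :
    inner ℂ (π.localAct v (atkinLehnerMatrix ϖ) x) y =
      inner ℂ x (π.localAct v (atkinLehnerMatrix ϖ) y) := by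
  rw [← (π.localAct v (atkinLehnerMatrix ϖ)).inner_map_map x, atkinLehner_atkinLehner]

/-- If there are no vectors of level one, then the local matrix coefficients of a vector `x` of
level `v` against vectors `y` fixed by the Iwahori subgroup are multiples of those at powers of the
Atkin–Lehner matrix, the factor being independent of `x` and `y`. For the powers of `diag(1, ϖ)`
the factors `(-1 / N v) ^ n` come from the vanishing of the trace of `x` to level one. -/
theorem exists_inner_localAct_eq (h : π.fixedBy (KZero (⊤ : Ideal (𝓞 F))) = ⊥)
    {ϖ : (v.adicCompletion F)ˣ} (hϖ : IsUniformizer ϖ) (a : GLLocal v) :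
    ∃ (c : ℂ) (n : ℕ), ∀ y ∈ π.localFixed (iwahori v), ∀ x ∈ π.fixedBy (KZero v.asIdeal),
      inner ℂ y (π.localAct v a x) = c * inner ℂ y (π.localAct v (atkinLehnerMatrix ϖ ^ n) x) := by
  induction a using atkinLehner_induction hϖ with
  | hl k hk g ih =>
    obtain ⟨c, n, ih⟩ := ih
    refine ⟨c, n, fun y hy x hx => ?_⟩
    rw [← ih y hy x hx, localAct_mul_apply, ← inv_inv k, ← inner_localAct_left,
      mem_localFixed.1 hy _ (inv_mem hk)]
  | hr k hk g ih =>
    obtain ⟨c, n, ih⟩ := ih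
    refine ⟨c, n, fun y hy x hx => ?_⟩
    rw [← ih y hy x hx, localAct_mul_apply,
      mem_localFixed.1 (π.fixedBy_KZero_le_localFixed hx) _ hk]
  | hz z g ih =>
    obtain ⟨c, n, ih⟩ := ih
    refine ⟨c, n, fun y hy x hx => ?_⟩
    rw [← ih y hy x hx, localAct_scalar_mul]
  | hul g ih =>
    obtain ⟨c, n, ih⟩ := ih
    refine ⟨c, n + 1, fun y hy x hx => ?_⟩
    have := ih _ (π.atkinLehner_mem_localFixed hϖ hy) x hx
    rwa [localAct_mul_apply, inner_atkinLehner_left, atkinLehner_atkinLehner,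
      inner_atkinLehner_left, ← localAct_mul_apply, ← pow_succ'] at this
  | hur g ih =>
    obtain ⟨c, n, ih⟩ := ih
    refine ⟨c, n + 1, fun y hy x hx => ?_⟩
    have := ih y hy _ (π.atkinLehner_mem hϖ hx)
    rwa [localAct_mul_apply, atkinLehner_atkinLehner, ← localAct_mul_apply, ← pow_succ] at this
  | hpow m =>
    induction m with
    | zero => exact ⟨1, 0, fun y hy x hx => by simp⟩
    | succ m ih =>
      obtain ⟨c, n, ih⟩ := ih
      let q : ℂ := Fintype.card (𝓞 F ⧸ v.asIdeal)
      have hq : q ≠ 0 := Nat.cast_ne_zero.2 Fintype.card_ne_zero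
      refine ⟨-q⁻¹ * c, n + 1, fun y hy x hx => ?_⟩
      -- The vanishing trace is a sum over the point `none` and the `q` points `some b` of the
      -- projective line. After translation by `diag(1, ϖ) ^ m u` the latter all contribute the
      -- coefficient at `diag(1, ϖ) ^ (m + 1)`, and the former is known by induction.
      have hsum := congrArg (fun z => inner ℂ y (π.localAct v
        (diagMatrix 1 ϖ ^ m * atkinLehnerMatrix ϖ) z)) (π.sum_iwahoriRep_eq_zero h hx)
      have hterm : ∀ b, inner ℂ y (π.localAct v (diagMatrix 1 ϖ ^ m * atkinLehnerMatrix ϖ)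
          (π.localAct v (iwahoriRep v (some b)) x)) =
          inner ℂ y (π.localAct v (diagMatrix 1 ϖ ^ (m + 1)) x) := by
        intro b
        have hlow : Valued.v (-((ϖ : v.adicCompletion F) ^ (m + 1) * residueRep b)) < 1 := by
          have hϖ1 : Valued.v (ϖ : v.adicCompletion F) < 1 := by
            rw [valued_lt_one_iff_le hϖ, div_self ϖ.ne_zero, map_one]
          rw [Valuation.map_neg, map_mul, map_pow]
          exact mul_lt_one_of_nonneg_of_lt_one_left zero_le
            (pow_lt_one₀ zero_le hϖ1 m.succ_ne_zero) (valued_residueRep_le b)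
        have e : diagMatrix 1 ϖ ^ m * atkinLehnerMatrix ϖ * iwahoriRep v (some b) =
            lowerUnip (-((ϖ : v.adicCompletion F) ^ (m + 1) * residueRep b)) *
              (scalar (Fin 2) (-1) * diagMatrix 1 ϖ ^ (m + 1)) := by
          rw [iwahoriRep, mul_assoc, ← mul_assoc (atkinLehnerMatrix ϖ), ← mul_assoc,
            diagMatrix_pow_mul_upperUnip, ← diagMatrix_mul_weyl,
            Matrix.GeneralLinearGroup.scalar_commute, ← weyl_mul_self,
            pow_succ (diagMatrix 1 ϖ)]
          simp only [mul_assoc]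
        rw [← localAct_mul_apply, e, localAct_mul_apply, localAct_scalar_mul,
          ← inv_inv (lowerUnip _), ← inner_localAct_left,
          mem_localFixed.1 hy _ (inv_mem (lowerUnip_mem hlow))]
      rw [map_sum, inner_sum, Fintype.sum_option, map_zero, inner_zero_right] at hsum
      simp only [hterm, Finset.sum_const, Finset.card_univ, nsmul_eq_mul] at hsum
      have hone : inner ℂ y (π.localAct v (diagMatrix 1 ϖ ^ m * atkinLehnerMatrix ϖ)
          (π.localAct v (iwahoriRep v none) x)) =
          c * inner ℂ y (π.localAct v (atkinLehnerMatrix ϖ ^ (n + 1)) x) := by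
        rw [pow_succ, localAct_mul_apply, localAct_mul_apply _ (_ ^ n), iwahoriRep, map_one]
        exact ih y hy _ (π.atkinLehner_mem hϖ hx)
      rw [hone] at hsum
      rw [mul_assoc, neg_mul, ← mul_neg, eq_inv_mul_iff_mul_eq₀ hq]
      linear_combination hsum

/-- If there are no vectors of level one, then the Atkin–Lehner matrix acts on the vectors of
level `v` by a scalar. -/
theorem exists_atkinLehner_eq [CompleteSpace H] (hπ : π.IsIrreducible)
    (h : π.fixedBy (KZero (⊤ : Ideal (𝓞 F))) = ⊥) {ϖ : (v.adicCompletion F)ˣ}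
    (hϖ : IsUniformizer ϖ) :
    ∃ c : ℝ, ∀ x ∈ π.fixedBy (KZero v.asIdeal),
      π.localAct v (atkinLehnerMatrix ϖ) x = c • x := by
  let E := π.fixedBy (KZero v.asIdeal)
  let T : E →ₗ[ℂ] E := LinearMap.restrict
    (π.localAct v (atkinLehnerMatrix ϖ)).toLinearEquiv.toLinearMap (p := E) (q := E)
    (fun x hx => π.atkinLehner_mem hϖ hx)
  have hT : ∀ x : E, (T x : H) = π.localAct v (atkinLehnerMatrix ϖ) x := fun x => rfl
  obtain ⟨c, hc⟩ := exists_eq_smul_of_compression_commute π.act hπ.2 E (π.isClosed_fixedBy _) T (by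
    intro g x y
    obtain ⟨b, hb, e⟩ := exists_eq_localInclusion_mul v g
    generalize Matrix.GeneralLinearGroup.map (finiteComponent v) g = a at e
    subst e
    have hb' : Matrix.GeneralLinearGroup.map (finiteComponent v) b⁻¹ = 1 := by
      rw [map_inv, hb, inv_one]
    have hy := π.act_mem_localFixed hb' (π.fixedBy_KZero_le_localFixed y.2)
    obtain ⟨c, n, hc⟩ := π.exists_inner_localAct_eq h hϖ a
    rw [inner_act_localInclusion_mul π hb, inner_act_localInclusion_mul π hb, hT, hT,
      act_localAct_comm π hb', hc _ hy _ (π.atkinLehner_mem hϖ x.2),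
      hc _ (π.atkinLehner_mem_localFixed hϖ hy) _ x.2, inner_atkinLehner_left,
      ← localAct_mul_apply, ← localAct_mul_apply, ← pow_succ, ← pow_succ'])
  refine ⟨c, fun x hx => ?_⟩
  rw [← hT ⟨x, hx⟩, hc]
  rfl

/-- The scalar by which the Atkin–Lehner matrix acts does not depend on the uniformizer. -/
theorem atkinLehner_eq_atkinLehner {ϖ ϖ' : (v.adicCompletion F)ˣ} (hϖ : IsUniformizer ϖ)
    (hϖ' : IsUniformizer ϖ') {x : H} (hx : x ∈ π.localFixed (iwahori v)) :
    π.localAct v (atkinLehnerMatrix ϖ') x = π.localAct v (atkinLehnerMatrix ϖ) x := by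
  rw [← diagMatrix_mul_atkinLehnerMatrix ϖ ϖ', localAct_mul_apply]
  exact mem_localFixed.1 (π.atkinLehner_mem_localFixed hϖ hx) _
    (diagMatrix_mem (a := 1) (by simp) (hϖ'.valued_div hϖ))

end AtkinLehner

end UnitaryRep

end Representations

/-! ### Invariant trilinear functionals -/

section Trilinear

open Matrix.GeneralLinearGroup (scalar)

variable {F : Type*} [Field F] [NumberField F] {v w : HeightOneSpectrum (𝓞 F)}

theorem diagMatrix_mul_weyl_mul_diagMatrix (ϖ : (v.adicCompletion F)ˣ) :
    diagMatrix 1 ϖ * weyl v * diagMatrix 1 ϖ = scalar (Fin 2) ϖ * weyl v := by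
  apply localGL_ext
  rw [Units.val_mul (scalar (Fin 2) ϖ), coe_scalar_fin_two]
  simp

variable {H : Type*} [NormedAddCommGroup H] [InnerProductSpace ℂ H] {π : UnitaryRep F H}
  {H₁ : Type*} [NormedAddCommGroup H₁] [InnerProductSpace ℂ H₁] {π₁ : UnitaryRep F H₁}
  {H₂ : Type*} [NormedAddCommGroup H₂] [InnerProductSpace ℂ H₂] {π₂ : UnitaryRep F H₂}
  {V : Submodule ℂ H} {V₁ : Submodule ℂ H₁} {V₂ : Submodule ℂ H₂}

/-- On spherical vectors the product `diag(1, ϖ) w diag(1, ϖ)`, where `w` is the Weyl element, acts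
as the identity. -/
theorem UnitaryRep.localAct_diagMatrix_weyl_shift {x : H} (ϖ : (v.adicCompletion F)ˣ)
    (hx : x ∈ π.localFixed (localMaxCompact v)) :
    π.localAct v (diagMatrix 1 ϖ * weyl v) (π.act (shift ϖ) x) = x := by
  rw [shift, ← localAct_apply, ← localAct_mul_apply, diagMatrix_mul_weyl_mul_diagMatrix,
    localAct_scalar_mul, mem_localFixed.1 hx _ weyl_mem]

/-- The Hecke eigenvalue relation for an invariant trilinear functional: the value at `(φ, ψ, φ₂)`,
with `φ` replaced by its image under the Hecke operator, is a sum of equal terms, one for each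
point of the projective line over the residue field. -/
theorem hecke_trilinear (hvw : v ≠ w) [CompleteSpace H]
    (hV : π.IsInvariant V) (hV₁ : π₁.IsInvariant V₁) (hV₂ : π₂.IsInvariant V₂)
    (l : V →ₗ[ℂ] V₁ →ₗ[ℂ] V₂ →ₗ[ℂ] ℂ)
    (hl : ∀ g x x₁ x₂, l (π.actOn hV g x) (π₁.actOn hV₁ g x₁) (π₂.actOn hV₂ g x₂) = l x x₁ x₂)
    {φ : V} {φ₁ : V₁} {φ₂ : V₂} (hφ : (φ : H) ∈ π.localFixed (localMaxCompact v))
    (hφ₁ : π₁.IsSpherical v (φ₁ : H₁)) (hφ₂ : π₂.IsSpherical v (φ₂ : H₂))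
    {ϖv : (v.adicCompletion F)ˣ} {ϖw : (w.adicCompletion F)ˣ} (hϖv : IsUniformizer ϖv)
    (μ : Measure (GLLocal v)) [μ.IsHaarMeasure] (hμ : μ (localMaxCompact v : Set (GLLocal v)) = 1)
    {lam : ℝ} (hlam : π.hecke v μ (φ : H) = lam • (φ : H)) :
    (((Ideal.absNorm v.asIdeal + 1 : ℝ) / √(Ideal.absNorm v.asIdeal : ℝ) : ℝ) : ℂ) *
        l φ (π₁.actOn hV₁ (shift ϖw * shift ϖv) φ₁) (π₂.actOn hV₂ (shift ϖv) φ₂) =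
      (lam : ℂ) * l φ (π₁.actOn hV₁ (shift ϖw) φ₁) φ₂ := by
  set ψ := π₁.actOn hV₁ (shift ϖw) φ₁ with hψ_def
  have hψ : (ψ : H₁) ∈ π₁.localFixed (localMaxCompact v) :=
    π₁.act_mem_localFixed (map_finiteComponent_localInclusion_of_ne hvw _) hφ₁
  -- Translating by `g = r t w`, with `r` in `K_v`, `t = diag(1, ϖ)` and `w` the Weyl element,
  -- removes the shifts from the last two entries, because `t w t` is `w` times a scalar.
  have hterm : ∀ i, l (π.actOn hV (localInclusion v (heckeRep ϖv i)) φ) ψ φ₂ =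
      l φ (π₁.actOn hV₁ (shift ϖw * shift ϖv) φ₁) (π₂.actOn hV₂ (shift ϖv) φ₂) := by
    intro i
    have hi := isLeftTransversal_iwahoriRep.1 i
    rw [← hl (localInclusion v (iwahoriRep v i * (diagMatrix 1 ϖv * weyl v))) φ]
    congr 1
    · congr 1
      · congr 1
        refine Subtype.ext ?_
        change π.localAct v _ _ = π.localAct v _ _
        rw [heckeRep, ← mul_assoc, UnitaryRep.localAct_mul_apply _ _ (weyl v),
          UnitaryRep.mem_localFixed.1 hφ _ weyl_mem]
      · refine Subtype.ext ?_
        change (ψ : H₁) = π₁.localAct v _ (π₁.act (shift ϖw * shift ϖv) φ₁)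
        have : shift ϖw * shift ϖv = shift ϖv * shift ϖw :=
          (localInclusion_commute_localInclusion hvw _ _).eq
        rw [this, UnitaryRep.act_mul_apply, UnitaryRep.localAct_mul_apply]
        change (ψ : H₁) = π₁.localAct v _ (π₁.localAct v _ (π₁.act (shift ϖv) ψ))
        rw [UnitaryRep.localAct_diagMatrix_weyl_shift ϖv hψ, UnitaryRep.mem_localFixed.1 hψ _ hi]
    · refine Subtype.ext ?_
      change (φ₂ : H₂) = π₂.localAct v _ (π₂.act (shift ϖv) φ₂)
      rw [UnitaryRep.localAct_mul_apply, UnitaryRep.localAct_diagMatrix_weyl_shift ϖv hφ₂,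
        UnitaryRep.mem_localFixed.1 hφ₂ _ hi]
  have hsum : ((1 / √(Ideal.absNorm v.asIdeal : ℝ) : ℝ) : ℂ) •
      ∑ i, π.actOn hV (localInclusion v (heckeRep ϖv i)) φ = (lam : ℂ) • φ := by
    refine Subtype.ext ?_
    rw [π.hecke_eq_sum hϖv μ hμ hφ] at hlam
    rw [Submodule.coe_smul, Submodule.coe_smul, Submodule.coe_sum, Complex.coe_smul,
      Complex.coe_smul]
    exact hlam
  have := congrArg (fun x => l x ψ φ₂) hsum
  simp only [map_smul, map_sum, LinearMap.smul_apply, LinearMap.sum_apply, hterm,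
    Finset.sum_const, Finset.card_univ, Fintype.card_option, card_quotient_asIdeal, smul_eq_mul,
    nsmul_eq_mul] at this
  rw [← this]
  push_cast
  ring

/-- The Atkin–Lehner relation for an invariant trilinear functional, which is its invariance under
the Atkin–Lehner matrix: on spherical vectors this matrix acts as `shift ϖ` and as its inverse. -/
theorem atkinLehner_trilinear
    (hV : π.IsInvariant V) (hV₁ : π₁.IsInvariant V₁) (hV₂ : π₂.IsInvariant V₂)
    (l : V →ₗ[ℂ] V₁ →ₗ[ℂ] V₂ →ₗ[ℂ] ℂ)
    (hl : ∀ g x x₁ x₂, l (π.actOn hV g x) (π₁.actOn hV₁ g x₁) (π₂.actOn hV₂ g x₂) = l x x₁ x₂)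
    {φ : V} {φ₁ : V₁} {φ₂ : V₂}
    (hφ₁ : π₁.IsSpherical v (φ₁ : H₁)) (hφ₂ : π₂.IsSpherical v (φ₂ : H₂))
    {ϖ : (v.adicCompletion F)ˣ} {η : ℝ}
    (hη : π.act (localInclusion v (atkinLehnerMatrix ϖ)) (φ : H) = η • (φ : H)) :
    l φ φ₁ (π₂.actOn hV₂ (shift ϖ) φ₂) = (η : ℂ) * l φ (π₁.actOn hV₁ (shift ϖ) φ₁) φ₂ := by
  have e : π.actOn hV (localInclusion v (atkinLehnerMatrix ϖ)) φ = (η : ℂ) • φ := by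
    refine Subtype.ext ?_
    rw [Submodule.coe_smul, Complex.coe_smul]
    exact hη
  have e₁ : π₁.actOn hV₁ (localInclusion v (atkinLehnerMatrix ϖ)) φ₁ =
      π₁.actOn hV₁ (shift ϖ) φ₁ := by
    refine Subtype.ext ?_
    change π₁.localAct v _ _ = π₁.localAct v _ _
    rw [← diagMatrix_mul_weyl, UnitaryRep.localAct_mul_apply,
      UnitaryRep.mem_localFixed.1 hφ₁ _ weyl_mem]
  have e₂ : π₂.actOn hV₂ (localInclusion v (atkinLehnerMatrix ϖ)) (π₂.actOn hV₂ (shift ϖ) φ₂) =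
      φ₂ := by
    refine Subtype.ext ?_
    rw [← diagMatrix_mul_weyl]
    exact UnitaryRep.localAct_diagMatrix_weyl_shift ϖ hφ₂
  rw [← hl (localInclusion v (atkinLehnerMatrix ϖ)), e, e₁, e₂, map_smul, LinearMap.smul_apply,
    LinearMap.smul_apply, smul_eq_mul]

end Trilinear

end PGLTwo

end


theorem mainTheorem2 {F : Type*} [Field F] [NumberField F]
    (𝔭 𝔮 : HeightOneSpectrum (𝓞 F)) (hne : 𝔭 ≠ 𝔮)
    (μ : Measure (GL (Fin 2) (𝔭.adicCompletion F))) [μ.IsHaarMeasure]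
    (hμ : μ (PGLTwo.localMaxCompact 𝔭 : Set (GL (Fin 2) (𝔭.adicCompletion F))) = 1)
    {H : Type*} [NormedAddCommGroup H] [InnerProductSpace ℂ H] [CompleteSpace H]
    (π : PGLTwo.UnitaryRep F H) (hπ : π.IsUnitaryAutomorphic)
    (hcond : π.HasConductor 𝔮.asIdeal) :
    ∃ lam eta : ℝ,
      (∀ x ∈ π.fixedBy (PGLTwo.KZero 𝔮.asIdeal), π.hecke 𝔭 μ x = lam • x) ∧
      (eta = -1 ∨ eta = 1) ∧
      (∀ ϖ : (𝔮.adicCompletion F)ˣ, PGLTwo.IsUniformizer ϖ →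
        ∀ x ∈ π.fixedBy (PGLTwo.KZero 𝔮.asIdeal),
          π.act (PGLTwo.localInclusion 𝔮 (PGLTwo.atkinLehnerMatrix ϖ)) x = eta • x) ∧
      ∀ {H₁ : Type*} [NormedAddCommGroup H₁] [InnerProductSpace ℂ H₁] [CompleteSpace H₁]
        {H₂ : Type*} [NormedAddCommGroup H₂] [InnerProductSpace ℂ H₂] [CompleteSpace H₂]
        (π₁ : PGLTwo.UnitaryRep F H₁) (π₂ : PGLTwo.UnitaryRep F H₂),
        π₁.IsUnitaryAutomorphic → π₂.IsUnitaryAutomorphic →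
        ∀ (V : Submodule ℂ H) (V₁ : Submodule ℂ H₁) (V₂ : Submodule ℂ H₂)
          (hV : π.IsInvariant V) (hV₁ : π₁.IsInvariant V₁) (hV₂ : π₂.IsInvariant V₂)
          (l : V →ₗ[ℂ] V₁ →ₗ[ℂ] V₂ →ₗ[ℂ] ℂ),
          (∀ g x x₁ x₂,
            l (π.actOn hV g x) (π₁.actOn hV₁ g x₁) (π₂.actOn hV₂ g x₂) = l x x₁ x₂) →
          ∀ (φ : V) (φ₁ : V₁) (φ₂ : V₂),
            (φ : H) ∈ π.fixedBy (PGLTwo.KZero 𝔮.asIdeal) →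
            π₁.IsSpherical 𝔭 (φ₁ : H₁) → π₁.IsSpherical 𝔮 (φ₁ : H₁) →
            π₂.IsSpherical 𝔭 (φ₂ : H₂) → π₂.IsSpherical 𝔮 (φ₂ : H₂) →
            ∀ (ϖp : (𝔭.adicCompletion F)ˣ) (ϖq : (𝔮.adicCompletion F)ˣ),
              PGLTwo.IsUniformizer ϖp → PGLTwo.IsUniformizer ϖq →
              (((Ideal.absNorm 𝔭.asIdeal + 1 : ℝ) / √(Ideal.absNorm 𝔭.asIdeal : ℝ) : ℝ) : ℂ) *
                  l φ (π₁.actOn hV₁ (PGLTwo.shift ϖq * PGLTwo.shift ϖp) φ₁)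
                    (π₂.actOn hV₂ (PGLTwo.shift ϖp) φ₂) =
                (lam : ℂ) * l φ (π₁.actOn hV₁ (PGLTwo.shift ϖq) φ₁) φ₂ ∧
              l φ φ₁ (π₂.actOn hV₂ (PGLTwo.shift ϖq) φ₂) =
                (eta : ℂ) * l φ (π₁.actOn hV₁ (PGLTwo.shift ϖq) φ₁) φ₂ := by
  obtain ⟨ϖp₀, hϖp₀⟩ := PGLTwo.exists_isUniformizer 𝔭
  obtain ⟨ϖq₀, hϖq₀⟩ := PGLTwo.exists_isUniformizer 𝔮
  have hlevel : π.fixedBy (PGLTwo.KZero (⊤ : Ideal (𝓞 F))) = ⊥ := by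
    by_contra hcon
    exact 𝔮.isPrime.ne_top (top_le_iff.1 (Ideal.le_of_dvd ((hcond.2 ⊤ top_ne_bot).1 hcon)))
  obtain ⟨c, hc⟩ := π.exists_sum_heckeRep_eq hπ.1 hϖp₀
  obtain ⟨η, hη⟩ := π.exists_atkinLehner_eq hπ.1 hlevel hϖq₀
  have hη' : ∀ ϖ : (𝔮.adicCompletion F)ˣ, PGLTwo.IsUniformizer ϖ →
      ∀ x ∈ π.fixedBy (PGLTwo.KZero 𝔮.asIdeal),
        π.act (PGLTwo.localInclusion 𝔮 (PGLTwo.atkinLehnerMatrix ϖ)) x = η • x :=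
    fun ϖ hϖ x hx =>
      (π.atkinLehner_eq_atkinLehner hϖq₀ hϖ (π.fixedBy_KZero_le_localFixed hx)).trans (hη x hx)
  have hhecke : ∀ x ∈ π.fixedBy (PGLTwo.KZero 𝔮.asIdeal),
      π.hecke 𝔭 μ x = (1 / √(Ideal.absNorm 𝔭.asIdeal : ℝ) * c) • x := fun x hx => by
    have hx' := π.fixedBy_KZero_le_localFixed_of_ne hne hx
    rw [π.hecke_eq_sum hϖp₀ μ hμ hx', hc x hx', mul_smul]
  refine ⟨1 / √(Ideal.absNorm 𝔭.asIdeal : ℝ) * c, η, hhecke, ?_, hη', ?_⟩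
  · -- The conductor provides a nonzero vector `x` of level `𝔮`; the square of the
    -- Atkin–Lehner matrix is central, whence `η ^ 2 = 1`.
    obtain ⟨x, hx, hx0⟩ :=
      Submodule.exists_mem_ne_zero_of_ne_bot ((hcond.2 𝔮.asIdeal 𝔮.ne_bot).2 dvd_rfl)
    have hsq := π.atkinLehner_atkinLehner ϖq₀ x
    rw [hη x hx, ← Complex.coe_smul, map_smul, Complex.coe_smul, hη x hx, smul_smul] at hsq
    have : (η * η - 1) • x = 0 := by rw [sub_smul, hsq, one_smul, sub_self]
    rcases smul_eq_zero.1 this with h | h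
    · exact (mul_self_eq_one_iff.1 (sub_eq_zero.1 h)).symm
    · exact absurd h hx0
  · intro H₁ _ _ _ H₂ _ _ _ π₁ π₂ _ _ V V₁ V₂ hV hV₁ hV₂ l hl φ φ₁ φ₂ hφ h₁p h₁q h₂p h₂q ϖp ϖq
      hϖp hϖq
    exact ⟨PGLTwo.hecke_trilinear hne hV hV₁ hV₂ l hl (π.fixedBy_KZero_le_localFixed_of_ne hne hφ)
        h₁p h₂p hϖp μ hμ (hhecke _ hφ),
      PGLTwo.atkinLehner_trilinear hV hV₁ hV₂ l hl h₁q h₂q (hη' ϖq hϖq _ hφ)⟩
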